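/- An oriented graph $\Sigma$ on $n$ vertices $v_1,\dots,v_n$ is a simple graph with a direction assigned to each edge; its skew-adjacency matrix $S(\Sigma)=(s_{ij})$ has $s_{ij}=1$ if $(v_i,v_j)$ is an arc, $s_{ij}=-1$ if $(v_j,v_i)$ is an arc, and $s_{ij}=0$ otherwise. Its converse $\Sigma^{\rm T}$ is obtained by reversing all arcs, so that $S(\Sigma^{\rm T})=S(\Sigma)^{\rm T}=-S(\Sigma)$; $\Sigma$ is self-converse if it is isomorphic to $\Sigma^{\rm T}$. Let $e$ be the all-one vector, $J$ the all-one matrix, $W(\Sigma)=[e,S(\Sigma)e,\dots,S(\Sigma)^{n-1}e]$, and let $\mathcal G_n$ be the set of oriented graphs $\Sigma$ on $n$ vertices such that $2^{-\lfloor n/2\rfloor}\det W(\Sigma)$ is an odd and square-free integer. The generalized skew-spectrum of $\Sigma$ consists of the spectra (with multiplicities) of $S(\Sigma)$ and of $J-I-S(\Sigma)$; $\Sigma$ is DGSS if every oriented graph with the same generalized skew-spectrum is isomorphic to $\Sigma$. A regular rational orthogonal matrix is an orthogonal matrix $Q$ with rational entries and $Qe=e$; its level is the smallest positive integer $k$ such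 that $kQ$ is an integral matrix. Let $\mathcal Q(\Sigma)$ be the set of regular rational orthogonal matrices $Q$ of order $n$ such that $Q^{\rm T}S(\Sigma)Q$ is the skew-adjacency matrix of an oriented graph. **Theorem.** Let $\Sigma\in\mathcal G_n$. There is a unique regular rational orthogonal matrix $Q_0$ with $Q_0^{\rm T}S(\Sigma)Q_0=S(\Sigma^{\rm T})$. Let $\ell_0$ be its level. If $Q\in\mathcal Q(\Sigma)$ has level $\ell$, then $\ell\mid\ell_0$. In particular, if $\Sigma$ is self-converse, then $\Sigma$ is DGSS. -/

import Mathlib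

/-- An oriented graph on the vertex set `V`: a directed graph in which no two vertices are joined
by arcs in both directions (so there are no loops); equivalently, a simple graph together with a
direction for each of its edges. -/
structure OrientedGraph (V : Type*) extends Digraph V where
  asymm : ∀ u v, Adj u v → ¬ Adj v u

namespace OrientedGraph

variable {V : Type*}

/-- The converse of an oriented graph: every arc is reversed. -/
def converse (G : OrientedGraph V) : OrientedGraph V where
  Adj u v := G.Adj v u
  asymm u v h := G.asymm v u h

/-- Two oriented graphs are isomorphic if a bijection of the vertices preserves and reflects
arcs. -/
def Isomorphic (G H : OrientedGraph V) : Prop :=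
  ∃ f : V ≃ V, ∀ u v, G.Adj u v ↔ H.Adj (f u) (f v)

/-- An oriented graph is self-converse if it is isomorphic to its converse. -/
def SelfConverse (G : OrientedGraph V) : Prop :=
  G.Isomorphic G.converse

open Classical in
/-- The skew-adjacency matrix `S(G)`. -/
noncomputable def skewAdj (G : OrientedGraph V) : Matrix V V ℤ :=
  Matrix.of fun u v => if G.Adj u v then 1 else if G.Adj v u then -1 else 0

/-- The spectrum of an integral matrix: the multiset of its complex eigenvalues, with algebraic
multiplicities. -/
noncomputable def spec [Fintype V] [DecidableEq V] (A : Matrix V V ℤ) : Multiset ℂ :=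
  (A.map (Int.cast : ℤ → ℂ)).charpoly.roots

/-- The generalized skew-spectrum: the spectrum of `S(G)` and the spectrum of `J - I - S(G)`,
where `J` is the all-one matrix. -/
noncomputable def genSkewSpec [Fintype V] [DecidableEq V] (G : OrientedGraph V) :
    Multiset ℂ × Multiset ℂ :=
  (spec G.skewAdj, spec (Matrix.of (fun _ _ => (1 : ℤ)) - 1 - G.skewAdj))

/-- `G` is determined by its generalized skew-spectrum. -/
def IsDGSS [Fintype V] [DecidableEq V] (G : OrientedGraph V) : Prop :=
  ∀ H : OrientedGraph V, H.genSkewSpec = G.genSkewSpec → H.Isomorphic G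

variable {n : ℕ}

/-- The skew-walk matrix `W(G) = [e, S e, …, S ^ (n - 1) e]`, where `e` is the all-one vector. -/
noncomputable def skewWalk (G : OrientedGraph (Fin n)) : Matrix (Fin n) (Fin n) ℤ :=
  Matrix.of fun i j => ((G.skewAdj ^ (j : ℕ)).mulVec 1) i

/-- The class `𝒢_n` of the oriented graphs on `n` vertices such that `2 ^ (-⌊n / 2⌋) * det W(G)`
is an odd and square-free integer. -/
def oddSquarefreeClass (n : ℕ) : Set (OrientedGraph (Fin n)) :=
  {G | ∃ m : ℤ, G.skewWalk.det = 2 ^ (n / 2) * m ∧ Odd m ∧ Squarefree m}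

/-- `RO_n(ℚ)`: the rational orthogonal matrices `Q` of order `n` that are regular, `Q e = e`. -/
def regularOrthogonal (n : ℕ) : Set (Matrix (Fin n) (Fin n) ℚ) :=
  {Q | Q ∈ Matrix.orthogonalGroup (Fin n) ℚ ∧ Q.mulVec 1 = 1}

/-- The matrices `Q` in `RO_n(ℚ)` with `Qᵀ S(G) Q = S(H)`. -/
def transition (G H : OrientedGraph (Fin n)) : Set (Matrix (Fin n) (Fin n) ℚ) :=
  {Q | Q ∈ regularOrthogonal n ∧
    Q.transpose * G.skewAdj.map (Int.cast : ℤ → ℚ) * Q = H.skewAdj.map (Int.cast : ℤ → ℚ)}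

/-- `𝒬(G)`: the regular rational orthogonal matrices `Q` such that `Qᵀ S(G) Q` is the
skew-adjacency matrix of an oriented graph. -/
def transitions (G : OrientedGraph (Fin n)) : Set (Matrix (Fin n) (Fin n) ℚ) :=
  ⋃ H : OrientedGraph (Fin n), transition G H

/-- The level of a rational matrix `Q`: the smallest positive integer `k` such that `k Q` is an
integral matrix. -/
noncomputable def level (Q : Matrix (Fin n) (Fin n) ℚ) : ℕ :=
  sInf {k : ℕ | 0 < k ∧ ∃ M : Matrix (Fin n) (Fin n) ℤ, (k : ℚ) • Q = M.map (Int.cast : ℤ → ℚ)}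

/-- The infimum in the definition of the level is attained. -/
theorem level_spec (Q : Matrix (Fin n) (Fin n) ℚ) :
    0 < level Q ∧
      ∃ M : Matrix (Fin n) (Fin n) ℤ, (level Q : ℚ) • Q = M.map (Int.cast : ℤ → ℚ) := by
  refine Nat.sInf_mem (s := {k : ℕ | 0 < k ∧ ∃ M : Matrix (Fin n) (Fin n) ℤ,
    (k : ℚ) • Q = M.map (Int.cast : ℤ → ℚ)}) ?_
  refine ⟨∏ p : Fin n × Fin n, (Q p.1 p.2).den,
    Finset.prod_pos fun p _ => (Q p.1 p.2).den_pos, ?_⟩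
  have h : ∀ i j, ∃ z : ℤ, ((∏ p : Fin n × Fin n, (Q p.1 p.2).den : ℕ) : ℚ) * Q i j = z := by
    intro i j
    obtain ⟨c, hc⟩ := Finset.dvd_prod_of_mem (fun p : Fin n × Fin n => (Q p.1 p.2).den)
      (Finset.mem_univ (i, j))
    refine ⟨c * (Q i j).num, ?_⟩
    rw [hc]
    push_cast
    have := Rat.mul_den_eq_num (Q i j)
    linear_combination (c : ℚ) * this
  choose M hM using h
  exact ⟨Matrix.of M, by ext i j; simpa using hM i j⟩

end OrientedGraph

/-! Write `S` for the skew-adjacency matrix, `W` for the walk matrix and `e` for the all-one vector.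
Two graphs with the same generalized skew-spectrum have the same characteristic polynomials of `S`
and of `S + J`; by the matrix determinant lemma they have the same moments `eᵀ S ^ k e`. Up to sign,
these are the entries of `Wᵀ W`, because `S` is skew. So when `det W ≠ 0` the matrix carrying one
`W` to the other is orthogonal and fixes `e`, and `Qᵀ W(G) = W(H)` leaves no other choice for `Q`.
With the converse in place of `H` this gives `Q₀`.

The same identity shows that the level `ℓ` divides `det W`. If a prime `p` divides `ℓ`, some column
`z` of `ℓ Q` is nonzero modulo `p`, while `Wᵀ z ≡ 0` modulo `p` and `zᵀ S ^ k z ≡ 0` modulo `p ^ 2`.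

For `p = 2` this is impossible: the kernel of `Wᵀ` modulo `2` is spanned by half of the vectors `S ^
i e`, and on it the conditions modulo `4` become linear and force `z ≡ 0`
(`two_dvd_of_krylov_transpose_mulVec`). Hence `ℓ` is odd and divides the square-free odd part of
`det W`.

Let `p` be odd, not dividing `ℓ₀`, with `p ^ 2 ∤ det W`. The kernel of `Wᵀ` modulo `p` is then the
line of `z`, stable under `S` and under `N = ℓ₀ Q₀`; say `S z = a z` and `N z = c z`. From `S N = -N
S` comes `2 a c = 0`, and `c ≠ 0` because `Nᵀ N = ℓ₀ ^ 2`. So `S z = 0`, with `z` isotropic and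
orthogonal to `e`. Such a `z` lifts to a kernel vector of `Wᵀ` modulo `p ^ 2`, whence `p ^ 2 ∣ det
W` (`sq_dvd_det_krylov`), a contradiction. Thus each prime factor of the square-free `ℓ` divides
`ℓ₀`. For a self-converse graph `ℓ₀ = 1`, and a `Q` of level `1` is a permutation matrix. -/

open Matrix

/-- The matrix `[e, A e, …, A ^ (n - 1) e]`, where `e` is the all-one vector. -/
def krylov {R : Type*} [CommRing R] {n : ℕ} (A : Matrix (Fin n) (Fin n) R) :
    Matrix (Fin n) (Fin n) R :=
  Matrix.of fun i j => ((A ^ (j : ℕ)) *ᵥ 1) i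

/-- The number `eᵀ A ^ k e`, where `e` is the all-one vector. -/
def moment {V R : Type*} [Fintype V] [DecidableEq V] [CommRing R] (A : Matrix V V R) (k : ℕ) : R :=
  1 ⬝ᵥ ((A ^ k) *ᵥ 1)

/-! ### Moments as invariants of the two characteristic polynomials -/

section Moments

variable {V R : Type*} [Fintype V] [DecidableEq V] [CommRing R]

/-- The generating series `∑ A ^ k t ^ k` of the powers of a matrix. -/
noncomputable def powSeries (A : Matrix V V R) : Matrix V V (PowerSeries R) :=
  Matrix.of fun i j => PowerSeries.mk fun k => (A ^ k) i j

/-- The generating series `∑ A ^ k t ^ k` is the inverse of `1 - t A`. -/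
theorem one_sub_X_smul_mul_mk_pow (A : Matrix V V R) :
    (1 - (PowerSeries.X : PowerSeries R) • A.map (PowerSeries.C (R := R))) *
      powSeries A = 1 := by
  have key : (PowerSeries.X : PowerSeries R) • (A.map (PowerSeries.C (R := R)) *
      powSeries A) + 1 =
      powSeries A := by
    ext i j k
    cases k with
    | zero => by_cases h : i = j <;> simp [powSeries, h]
    | succ k =>
      have h1 : PowerSeries.coeff (k + 1) ((1 : Matrix V V (PowerSeries R)) i j) = 0 := by
        rw [Matrix.one_apply]; split_ifs <;> simp [PowerSeries.coeff_one]
      simp [powSeries, Matrix.mul_apply, pow_succ', PowerSeries.coeff_succ_X_mul, h1]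
  rw [sub_mul, one_mul, Matrix.smul_mul, sub_eq_iff_eq_add, add_comm, key]

theorem coe_charpolyRev (A : Matrix V V R) :
    (A.charpolyRev : PowerSeries R) =
      (1 - (PowerSeries.X : PowerSeries R) • A.map (PowerSeries.C (R := R))).det := by
  rw [Matrix.charpolyRev, ← Polynomial.coeToPowerSeries.ringHom_apply, RingHom.map_det]
  congr 1
  ext1 i j
  simp [Matrix.one_apply, apply_ite]
  exact mul_comm _ _

/-- The perturbation has rank one, so it factors as `A` times `1 +` (column)(row), the column being
`N` applied to the constant vector. -/
theorem det_add_const {A N : Matrix V V R} (hN : A * N = 1) (c : R) :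
    (A + Matrix.of fun _ _ => c).det = A.det * (1 + 1 ⬝ᵥ (N *ᵥ fun _ => c)) := by
  rw [← det_one_add_replicateCol_mul_replicateRow (ι := Unit), ← det_mul, Matrix.mul_add,
    Matrix.mul_one, ← Matrix.mul_assoc]
  congr 2
  ext i j
  have h1 : A *ᵥ (N *ᵥ fun _ => c) = fun _ => c := by rw [mulVec_mulVec, hN, one_mulVec]
  have h2 : (A * replicateCol Unit (N *ᵥ fun _ => c)) i () = c := congrFun h1 i
  rw [Matrix.mul_apply, Fintype.sum_unique]
  simpa using h2.symm

/-- The matrix determinant lemma for the reversed characteristic polynomial of `A + J`. -/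
theorem coe_charpolyRev_add_ones (A : Matrix V V R) :
    ((A + Matrix.of fun _ _ => (1 : R)).charpolyRev : PowerSeries R) =
      (A.charpolyRev : PowerSeries R) *
        (1 - PowerSeries.X * PowerSeries.mk (moment A)) := by
  have h1 : (1 - (PowerSeries.X : PowerSeries R) •
      (A + Matrix.of fun _ _ => (1 : R)).map (PowerSeries.C (R := R))) =
      (1 - (PowerSeries.X : PowerSeries R) • A.map (PowerSeries.C (R := R))) +
      Matrix.of fun _ _ => -(PowerSeries.X : PowerSeries R) := by
    ext1 i j
    simp
    ring
  have h2 : PowerSeries.mk (moment A) = ∑ i, ∑ j, powSeries A i j := by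
    ext k
    simp [powSeries, moment, dotProduct, mulVec]
  rw [coe_charpolyRev, coe_charpolyRev, h1, det_add_const (one_sub_X_smul_mul_mk_pow A), h2]
  congr 1
  rw [sub_eq_add_neg]
  simp only [dotProduct, mulVec, Pi.one_apply, one_mul, mul_neg, Finset.sum_neg_distrib,
    Finset.mul_sum, Finset.sum_mul, mul_comm]

/-- The reversed characteristic polynomial of `A` is a unit among power series, so it cancels from
the determinant formula and leaves the generating series of the moments. -/
theorem moment_eq_of_charpoly_eq {A B : Matrix V V R} (h : A.charpoly = B.charpoly)
    (hJ : (A + Matrix.of fun _ _ => (1 : R)).charpoly =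
      (B + Matrix.of fun _ _ => (1 : R)).charpoly) (k : ℕ) : moment A k = moment B k := by
  have h1 : A.charpolyRev = B.charpolyRev := by
    rw [← reverse_charpoly, h, reverse_charpoly]
  have h2 := coe_charpolyRev_add_ones A
  rw [← reverse_charpoly, hJ, reverse_charpoly, coe_charpolyRev_add_ones B, ← h1] at h2
  have hu : IsUnit (A.charpolyRev : PowerSeries R) := by
    rw [coe_charpolyRev]
    exact (Matrix.isUnit_iff_isUnit_det _).1
      (IsUnit.of_mul_eq_one _ (one_sub_X_smul_mul_mk_pow A))
  have h3 := congrArg (PowerSeries.coeff (k + 1)) (hu.mul_left_cancel h2)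
  simp only [map_sub, PowerSeries.coeff_succ_X_mul, PowerSeries.coeff_mk] at h3
  exact (sub_right_injective h3).symm

theorem moment_map {R' : Type*} [CommRing R'] (f : R →+* R') (A : Matrix V V R) (k : ℕ) :
    moment (A.map f) k = f (moment A k) := by
  have h : (A.map f) ^ k = (A ^ k).map f := (map_pow f.mapMatrix A k).symm
  simp [moment, h, dotProduct, mulVec]

end Moments

/-! ### Krylov matrices of skew-symmetric matrices -/

theorem krylov_map {R R' : Type*} [CommRing R] [CommRing R'] {n : ℕ} (f : R →+* R')
    (A : Matrix (Fin n) (Fin n) R) : krylov (A.map f) = (krylov A).map f := by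
  ext i j
  have h : (A.map f) ^ (j : ℕ) = (A ^ (j : ℕ)).map f := (map_pow f.mapMatrix A j).symm
  simp [krylov, h, mulVec, dotProduct]

theorem transpose_pow_of_skew {V R : Type*} [Fintype V] [DecidableEq V] [CommRing R]
    {A : Matrix V V R} (hA : Aᵀ = -A) (k : ℕ) : (A ^ k)ᵀ = (-1) ^ k • A ^ k := by
  rw [transpose_pow, hA, neg_pow]
  rcases Nat.even_or_odd k with h | h <;> simp [h.neg_one_pow]

/-- For a skew-symmetric `A`, the Gram matrix of `e, A e, A² e, …` consists of signed moments. -/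
theorem pow_mulVec_dotProduct_of_skew {V R : Type*} [Fintype V] [DecidableEq V] [CommRing R]
    {A : Matrix V V R} (hA : Aᵀ = -A) (i j : ℕ) (x y : V → R) :
    ((A ^ i) *ᵥ x) ⬝ᵥ ((A ^ j) *ᵥ y) = (-1) ^ i * (x ⬝ᵥ ((A ^ (i + j)) *ᵥ y)) := by
  rw [dotProduct_comm, dotProduct_mulVec, ← mulVec_transpose, transpose_pow_of_skew hA,
    smul_mulVec, smul_dotProduct, dotProduct_comm, mulVec_mulVec, ← pow_add]
  rcases Nat.even_or_odd i with h | h <;> simp [h.neg_one_pow]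

theorem krylov_transpose_mulVec {R : Type*} [CommRing R] {n : ℕ} (A : Matrix (Fin n) (Fin n) R)
    (x : Fin n → R) (i : Fin n) : ((krylov A)ᵀ *ᵥ x) i = ((A ^ (i : ℕ)) *ᵥ 1) ⬝ᵥ x := rfl

theorem gram_krylov {R : Type*} [CommRing R] {n : ℕ} {A : Matrix (Fin n) (Fin n) R}
    (hA : Aᵀ = -A) (i j : Fin n) :
    ((krylov A)ᵀ * krylov A) i j = (-1) ^ (i : ℕ) * moment A (i + j) :=
  pow_mulVec_dotProduct_of_skew hA i j 1 1

/-- If `A` and `B` have equal moments, the linear map that sends `A ^ k e` to `B ^ k e` is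
orthogonal and conjugates `A` to `B`. -/
theorem exists_orthogonal_of_moment_eq {K : Type*} [Field K] {n : ℕ}
    {A B : Matrix (Fin n) (Fin n) K} (hA : Aᵀ = -A) (hB : Bᵀ = -B)
    (hm : ∀ k, moment A k = moment B k) (hW : (krylov A).det ≠ 0) :
    ∃ Q : Matrix (Fin n) (Fin n) K, Qᵀ * Q = 1 ∧ Q *ᵥ 1 = 1 ∧ Qᵀ * A * Q = B := by
  have hG : (krylov A)ᵀ * krylov A = (krylov B)ᵀ * krylov B := by
    ext i j; rw [gram_krylov hA, gram_krylov hB, hm]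
  have hWB : (krylov B).det ≠ 0 := by
    intro h
    have := congrArg Matrix.det hG
    simp [h, hW] at this
  have uA : IsUnit (krylov A).det := hW.isUnit
  have uB : IsUnit (krylov B).det := hWB.isUnit
  set P := krylov B * (krylov A)⁻¹
  have hPA : P * krylov A = krylov B := nonsing_inv_mul_cancel_right _ _ uA
  clear_value P
  have hPP : Pᵀ * P = 1 := by
    have h1 : (krylov A)ᵀ * (Pᵀ * P) * krylov A = (krylov A)ᵀ * krylov A := by
      rw [hG]
      simp only [← hPA, transpose_mul, Matrix.mul_assoc]
    have h2 : (krylov A)ᵀ * (Pᵀ * P) = (krylov A)ᵀ * 1 := by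
      rw [Matrix.mul_one]
      exact ((Matrix.isUnit_iff_isUnit_det _).2 uA).mul_right_cancel h1
    have uAt : IsUnit ((krylov A)ᵀ) := by
      rw [Matrix.isUnit_iff_isUnit_det, det_transpose]; exact uA
    exact uAt.mul_left_cancel h2
  -- This holds by definition of `P` only for `k < n`. The exponent `n`, needed for `P A = B P` on
  -- the last column, comes from pairing with the columns of `krylov B`, which sees only moments.
  have hk : ∀ k, P *ᵥ ((A ^ k) *ᵥ 1) = (B ^ k) *ᵥ 1 := by
    intro k
    have h1 : (krylov B)ᵀ *ᵥ (P *ᵥ ((A ^ k) *ᵥ 1)) = (krylov B)ᵀ *ᵥ ((B ^ k) *ᵥ 1) := by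
      rw [← hPA, transpose_mul, mulVec_mulVec, Matrix.mul_assoc, hPP, Matrix.mul_one,
        ← transpose_mul, hPA]
      ext i
      rw [krylov_transpose_mulVec, krylov_transpose_mulVec, pow_mulVec_dotProduct_of_skew hA,
        pow_mulVec_dotProduct_of_skew hB]
      exact congrArg _ (hm _)
    refine Matrix.mulVec_injective_of_isUnit ?_ h1
    rw [Matrix.isUnit_iff_isUnit_det, det_transpose]; exact uB
  have hc : P * A = B * P := by
    refine ((Matrix.isUnit_iff_isUnit_det _).2 uA).mul_right_cancel ?_
    rw [Matrix.mul_assoc B, hPA]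
    ext i j
    have h1 := congrFun (hk (j + 1)) i
    rw [pow_succ', pow_succ', ← mulVec_mulVec, ← mulVec_mulVec] at h1
    rw [Matrix.mul_assoc]
    exact h1
  have hPP' : P * Pᵀ = 1 := mul_eq_one_comm.1 hPP
  refine ⟨Pᵀ, by simpa using hPP', ?_, ?_⟩
  · have h1 := hk 0
    simp only [pow_zero, one_mulVec] at h1
    nth_rewrite 1 [← h1]
    rw [mulVec_mulVec, hPP, one_mulVec]
  · rw [transpose_transpose, hc, Matrix.mul_assoc, hPP', Matrix.mul_one]

/-! ### Kernels modulo a prime and divisibility of determinants -/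

/-- If the kernel of an integral matrix modulo `p` contains `r` linearly independent vectors, then
`p ^ r` divides the determinant. -/
theorem prime_pow_card_dvd_det {V ι : Type*} [Fintype V] [DecidableEq V] [Fintype ι] (p : ℕ)
    [Fact p.Prime] (M : Matrix V V ℤ) (v : ι → V → ZMod p) (hv : LinearIndependent (ZMod p) v)
    (hM : ∀ i, M.map (Int.cast : ℤ → ZMod p) *ᵥ v i = 0) : (p : ℤ) ^ Fintype.card ι ∣ M.det := by
  classical
  have hs := hv.linearIndepOn_id
  -- The vectors are completed to a basis modulo `p`, whose matrix is lifted to an integral `L` with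
  -- determinant prime to `p`. The columns of `M L` coming from `v` are divisible by `p`.
  let c := Module.Basis.extend hs
  let σ : V ≃ hs.extend (Set.subset_univ _) := (Pi.basisFun (ZMod p) V).indexEquiv c
  let P : Matrix V V (ZMod p) := (Pi.basisFun (ZMod p) V).toMatrix (c.reindex σ.symm)
  have hPcol : ∀ i j, P i j = (σ j : V → ZMod p) i := fun i j => by
    simp [P, Module.Basis.toMatrix_apply, c]
  have hP : IsUnit P.det := by
    have := (Pi.basisFun (ZMod p) V).isUnit_det (c.reindex σ.symm)
    rwa [Module.Basis.det_apply] at this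
  let L : Matrix V V ℤ := P.map fun a => (a.val : ℤ)
  have hL : L.map (Int.cast : ℤ → ZMod p) = P := by
    ext i j; simp [L]
  have hLdet : IsCoprime (p : ℤ) L.det := by
    refine ((Nat.prime_iff_prime_int.1 Fact.out).coprime_iff_not_dvd).2 fun h => ?_
    have h2 : (L.det : ZMod p) = (L.map (Int.cast : ℤ → ZMod p)).det :=
      RingHom.map_det (Int.castRingHom (ZMod p)) L
    rw [hL, (ZMod.intCast_zmod_eq_zero_iff_dvd _ _).2 h] at h2
    exact hP.ne_zero h2.symm
  let D : V → ℤ := fun j => if (σ j : V → ZMod p) ∈ Set.range v then p else 1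
  have hdvd : ∀ i j, D j ∣ (M * L) i j := by
    intro i j
    by_cases hj : (σ j : V → ZMod p) ∈ Set.range v
    · simp only [D, if_pos hj]
      rw [← ZMod.intCast_zmod_eq_zero_iff_dvd]
      obtain ⟨k, hk⟩ := hj
      have h1 := congrFun (hM k) i
      rw [hk] at h1
      rw [← hL] at hPcol
      simpa [Matrix.mul_apply, mulVec, dotProduct, ← hPcol] using h1
    · simp only [D, if_neg hj, one_dvd]
  choose N hN using hdvd
  have hML : M * L = Matrix.of N * Matrix.diagonal D := by
    ext i j
    rw [Matrix.mul_diagonal, hN, mul_comm, Matrix.of_apply]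
  have hcard : ∏ j, D j = (p : ℤ) ^ Fintype.card ι := by
    rw [Finset.prod_ite, Finset.prod_const, Finset.prod_const_one, mul_one]
    congr 1
    have hmem : ∀ k, v k ∈ hs.extend (Set.subset_univ _) := fun k =>
      hs.subset_extend _ ⟨k, rfl⟩
    rw [← Finset.card_univ]
    symm
    refine Finset.card_bij (fun k _ => σ.symm ⟨v k, hmem k⟩) ?_ ?_ ?_
    · intro k _
      simp
    · intro k _ l _ hkl
      exact hv.injective (congrArg Subtype.val (σ.symm.injective hkl))
    · intro j hj
      obtain ⟨k, hk⟩ := (Finset.mem_filter.1 hj).2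
      exact ⟨k, Finset.mem_univ _, by
        rw [Equiv.symm_apply_eq]; exact Subtype.ext hk⟩
  have h := congrArg Matrix.det hML
  rw [det_mul, det_mul, det_diagonal, hcard] at h
  exact hLdet.pow_left.dvd_of_dvd_mul_right (Dvd.intro_left _ h.symm)

/-- A subspace of `K ^ V` contains every vector annihilated by its orthogonal complement. -/
theorem mem_of_forall_dotProduct_eq_zero {V K : Type*} [Fintype V] [DecidableEq V] [Field K]
    (p : Submodule K (V → K)) (b : V → K)
    (h : ∀ w : V → K, (∀ x ∈ p, w ⬝ᵥ x = 0) → w ⬝ᵥ b = 0) : b ∈ p := by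
  by_contra hb
  obtain ⟨f, hf, hp⟩ := Submodule.exists_le_ker_of_notMem hb
  have key : ∀ x, (dotProductEquiv K V).symm f ⬝ᵥ x = f x := fun x => by
    conv_rhs => rw [← (dotProductEquiv K V).apply_symm_apply f]
    rfl
  apply hf
  rw [← key]
  exact h _ fun x hx => by rw [key]; exact hp hx

theorem dotProduct_mulVec_of_skew {V R : Type*} [Fintype V] [CommRing R] {A : Matrix V V R}
    (hA : Aᵀ = -A) (x y : V → R) :
    x ⬝ᵥ (A *ᵥ y) = -((A *ᵥ x) ⬝ᵥ y) := by
  rw [dotProduct_mulVec, ← mulVec_transpose, hA, neg_mulVec, neg_dotProduct]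

/-! ### Isotropic kernel vectors of a skew-symmetric matrix over a field -/

section IsotropicKernel

variable {V K : Type*} [Fintype V] [DecidableEq V] [Field K] {A : Matrix V V K} {z : V → K}

/-- By skewness the orthogonal complement of `range A + ⟨e⟩` is `ker A ∩ e^⊥`, which lies in `⟨z⟩`;
double orthogonality concludes. -/
theorem exists_eq_mulVec_add_smul_of_dotProduct_eq_zero (hA : Aᵀ = -A)
    (hK : ∀ w, A *ᵥ w = 0 → 1 ⬝ᵥ w = 0 → ∃ c : K, w = c • z) (b : V → K) (hb : z ⬝ᵥ b = 0) :
    ∃ y, ∃ c : K, b = A *ᵥ y + c • 1 := by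
  have h : b ∈ LinearMap.range A.mulVecLin ⊔ Submodule.span K {1} := by
    refine mem_of_forall_dotProduct_eq_zero _ _ fun w hw => ?_
    have h1 : A *ᵥ w = 0 := by
      refine dotProduct_eq_zero_iff.1 fun x => ?_
      rw [← neg_eq_zero, ← dotProduct_mulVec_of_skew hA]
      exact hw _ (Submodule.mem_sup_left ⟨x, rfl⟩)
    have h2 : 1 ⬝ᵥ w = 0 := by
      rw [dotProduct_comm]
      exact hw _ (Submodule.mem_sup_right (Submodule.mem_span_singleton_self _))
    obtain ⟨c, rfl⟩ := hK w h1 h2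
    rw [smul_dotProduct, hb, smul_zero]
  obtain ⟨x, ⟨y, rfl⟩, x', hx', rfl⟩ := Submodule.mem_sup.1 h
  obtain ⟨c, rfl⟩ := Submodule.mem_span_singleton.1 hx'
  exact ⟨y, c, rfl⟩

theorem exists_eq_mulVec_of_forall_ker (hA : Aᵀ = -A) (b : V → K)
    (h : ∀ w, A *ᵥ w = 0 → w ⬝ᵥ b = 0) : ∃ y, b = A *ᵥ y := by
  have h : b ∈ LinearMap.range A.mulVecLin := by
    refine mem_of_forall_dotProduct_eq_zero _ _ fun w hw => h w ?_
    refine dotProduct_eq_zero_iff.1 fun x => ?_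
    rw [← neg_eq_zero, ← dotProduct_mulVec_of_skew hA]
    exact hw _ ⟨x, rfl⟩
  obtain ⟨y, rfl⟩ := h
  exact ⟨y, rfl⟩

/-- Under the hypothesis that `A w ∈ ⟨z⟩` and `e ⬝ w = 0` force `w ∈ ⟨z⟩`, an isotropic kernel
vector `z` of a skew-symmetric `A` can be corrected: `⟨z⟩` is hit by a vector not orthogonal
to `e`. -/
theorem exists_mulVec_mem_span_and_dotProduct_one (hA : Aᵀ = -A) (hz : z ≠ 0) (hAz : A *ᵥ z = 0)
    (hzz : z ⬝ᵥ z = 0)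
    (hK : ∀ w, (∃ c : K, A *ᵥ w = c • z) → 1 ⬝ᵥ w = 0 → ∃ c : K, w = c • z) :
    ∃ u, (∃ c : K, A *ᵥ u = c • z) ∧ 1 ⬝ᵥ u ≠ 0 := by
  by_contra! hU
  -- Otherwise `e` is orthogonal to `ker A`, so `e = A x`; since `z` is isotropic, `z = A (y + c
  -- x)`, and then `y + c x` lies in `⟨z⟩`, which `A` kills.
  obtain ⟨x, hx⟩ := exists_eq_mulVec_of_forall_ker hA 1 fun w hw => by
    rw [dotProduct_comm]; exact hU w ⟨0, by rw [hw, zero_smul]⟩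
  obtain ⟨y, c, hy⟩ := exists_eq_mulVec_add_smul_of_dotProduct_eq_zero hA
    (fun w hw => hK w ⟨0, by rw [hw, zero_smul]⟩) z hzz
  rw [hx, ← mulVec_smul, ← mulVec_add] at hy
  obtain ⟨d, hd⟩ := hK _ ⟨1, by rw [← hy, one_smul]⟩ (hU _ ⟨1, by rw [← hy, one_smul]⟩)
  rw [hd, mulVec_smul, hAz, smul_zero] at hy
  exact hz hy

theorem one_mem_range_mulVec_add_span (hA : Aᵀ = -A) (hz : z ≠ 0) (hAz : A *ᵥ z = 0)
    (hzz : z ⬝ᵥ z = 0)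
    (hK : ∀ w, (∃ c : K, A *ᵥ w = c • z) → 1 ⬝ᵥ w = 0 → ∃ c : K, w = c • z) :
    ∃ y, ∃ c : K, 1 = A *ᵥ y + c • z := by
  obtain ⟨y, c, hy⟩ := exists_eq_mulVec_add_smul_of_dotProduct_eq_zero hA
    (fun w hw => hK w ⟨0, by rw [hw, zero_smul]⟩) z hzz
  by_cases hc : c = 0
  · rw [hc, zero_smul, add_zero] at hy
    have hey : 1 ⬝ᵥ y ≠ 0 := fun h => by
      obtain ⟨d, hd⟩ := hK y ⟨1, by rw [← hy, one_smul]⟩ h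
      rw [hd, mulVec_smul, hAz, smul_zero] at hy
      exact hz hy
    obtain ⟨x, hx⟩ := exists_eq_mulVec_of_forall_ker hA 1 fun w hw => by
      -- Subtracting `t y` makes `w` orthogonal to `e`, so `hK` applies; as `A y = z`, this forces
      -- `t = 0`, and `e` is orthogonal to `ker A`.
      set t := (1 ⬝ᵥ w) / (1 ⬝ᵥ y) with ht
      have h1 : A *ᵥ (w - t • y) = (-t) • z := by
        rw [mulVec_sub, mulVec_smul, hw, ← hy, zero_sub, neg_smul]
      obtain ⟨d, hd⟩ := hK (w - t • y) ⟨_, h1⟩ (by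
        rw [dotProduct_sub, dotProduct_smul, ht, smul_eq_mul, div_mul_cancel₀ _ hey, sub_self])
      rw [hd, mulVec_smul, hAz, smul_zero, eq_comm, smul_eq_zero, neg_eq_zero] at h1
      have h2 : t = 0 := h1.resolve_right hz
      rw [dotProduct_comm]
      exact (div_eq_zero_iff.1 (ht ▸ h2)).resolve_right hey
    exact ⟨x, 0, by rw [← hx, zero_smul, add_zero]⟩
  · refine ⟨-(c⁻¹ • y), c⁻¹, ?_⟩
    rw [mulVec_neg, mulVec_smul, neg_add_eq_sub, ← smul_sub, eq_inv_smul_iff₀ hc, eq_sub_iff_add_eq,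
      add_comm]
    exact hy.symm

end IsotropicKernel

/-! ### Odd primes: lifting a kernel vector from modulus `p` to `p ^ 2` -/

theorem map_mulVec_intCast {V : Type*} [Fintype V] (R : Type*) [CommRing R] (M : Matrix V V ℤ)
    (x : V → ℤ) (i : V) :
    (M.map (Int.cast : ℤ → R) *ᵥ fun j => (x j : R)) i = ((M *ᵥ x) i : R) := by
  simp [mulVec, dotProduct]

theorem transpose_map_intCast_of_skew {V : Type*} (R : Type*) [CommRing R] {S : Matrix V V ℤ}
    (hS : Sᵀ = -S) : (S.map (Int.cast : ℤ → R))ᵀ = -S.map (Int.cast : ℤ → R) := by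
  rw [← transpose_map, hS]
  ext i j
  simp

theorem krylov_map_intCast {n : ℕ} (R : Type*) [CommRing R] (S : Matrix (Fin n) (Fin n) ℤ) :
    krylov (S.map (Int.cast : ℤ → R)) = (krylov S).map (Int.cast : ℤ → R) :=
  krylov_map (Int.castRingHom R) S

theorem pow_mulVec_one_dotProduct_of_skew {V R : Type*} [Fintype V] [DecidableEq V] [CommRing R]
    {A : Matrix V V R} (hA : Aᵀ = -A) (k : ℕ) (x : V → R) :
    ((A ^ k) *ᵥ 1) ⬝ᵥ x = (-1) ^ k * (1 ⬝ᵥ ((A ^ k) *ᵥ x)) := by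
  simpa using pow_mulVec_dotProduct_of_skew hA k 0 1 x

/-- A vector orthogonal to `e` that `A` maps to a kernel vector orthogonal to `e` is orthogonal
to all `A ^ k e`. -/
theorem krylov_transpose_mulVec_eq_zero {R : Type*} [CommRing R] {n : ℕ}
    {A : Matrix (Fin n) (Fin n) R} (hA : Aᵀ = -A) {z w : Fin n → R} {c : R} (hAz : A *ᵥ z = 0)
    (hez : 1 ⬝ᵥ z = 0) (hAw : A *ᵥ w = c • z) (hew : 1 ⬝ᵥ w = 0) : (krylov A)ᵀ *ᵥ w = 0 := by
  ext ⟨i, hi⟩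
  rw [krylov_transpose_mulVec, pow_mulVec_one_dotProduct_of_skew hA, Pi.zero_apply]
  match i with
  | 0 => simp [hew]
  | 1 => simp [hAw, hez]
  | k + 2 =>
    rw [show ((⟨k + 2, hi⟩ : Fin n) : ℕ) = k + 1 + 1 from rfl, pow_succ A, pow_succ A,
      ← mulVec_mulVec, ← mulVec_mulVec, hAw, mulVec_smul, hAz]
    simp

/-- Two independent kernel vectors would give a factor `p ^ 2` of the determinant. -/
theorem exists_eq_smul_of_krylov_transpose_mulVec_eq_zero {n p : ℕ} [Fact p.Prime]
    {S : Matrix (Fin n) (Fin n) ℤ} (hdet : ¬ (p : ℤ) ^ 2 ∣ (krylov S).det) {z w : Fin n → ZMod p}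
    (hz0 : z ≠ 0) (hz : (krylov (S.map (Int.cast : ℤ → ZMod p)))ᵀ *ᵥ z = 0)
    (hw : (krylov (S.map (Int.cast : ℤ → ZMod p)))ᵀ *ᵥ w = 0) : ∃ c : ZMod p, w = c • z := by
  by_contra! h
  have hli : LinearIndependent (ZMod p) ![z, w] :=
    (LinearIndependent.pair_iff' hz0).2 fun a ha => h a ha.symm
  have := prime_pow_card_dvd_det p (krylov S)ᵀ _ hli (by
    intro i
    rw [transpose_map, ← krylov_map_intCast]
    fin_cases i
    · exact hz
    · exact hw)
  rw [Fintype.card_fin, det_transpose] at this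
  exact hdet this

/-- If `S` is skew-symmetric and some isotropic vector modulo `p` lies in the kernel of `S` and is
orthogonal to `e`, then `p ^ 2` divides the determinant of the Krylov matrix. -/
theorem sq_dvd_det_krylov {n p : ℕ} [Fact p.Prime] {S : Matrix (Fin n) (Fin n) ℤ} (hS : Sᵀ = -S)
    {z : Fin n → ℤ} (hz0 : (fun i => (z i : ZMod p)) ≠ 0) (hSz : ∀ i, (p : ℤ) ∣ (S *ᵥ z) i)
    (hez : (p : ℤ) ∣ 1 ⬝ᵥ z) (hzz : (p : ℤ) ∣ z ⬝ᵥ z) : (p : ℤ) ^ 2 ∣ (krylov S).det := by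
  by_contra hdet
  have hp0 : (p : ℤ) ≠ 0 := by exact_mod_cast (Fact.out : p.Prime).ne_zero
  have hA := transpose_map_intCast_of_skew (ZMod p) hS
  set A := S.map (Int.cast : ℤ → ZMod p) with hAdef
  set zp : Fin n → ZMod p := fun i => (z i : ZMod p) with hzp
  have hAz : A *ᵥ zp = 0 := by
    ext i
    rw [map_mulVec_intCast, Pi.zero_apply, ZMod.intCast_zmod_eq_zero_iff_dvd]
    exact hSz i
  have hez' : 1 ⬝ᵥ zp = 0 := by
    rw [← ZMod.intCast_zmod_eq_zero_iff_dvd] at hez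
    simpa [dotProduct] using hez
  have hzz' : zp ⬝ᵥ zp = 0 := by
    rw [← ZMod.intCast_zmod_eq_zero_iff_dvd] at hzz
    simpa [dotProduct] using hzz
  have hK : ∀ w, (∃ c : ZMod p, A *ᵥ w = c • zp) → 1 ⬝ᵥ w = 0 → ∃ c : ZMod p, w = c • zp := by
    rintro w ⟨c, hc⟩ hw
    exact exists_eq_smul_of_krylov_transpose_mulVec_eq_zero hdet hz0
      (krylov_transpose_mulVec_eq_zero hA hAz hez' (hAz.trans (zero_smul _ zp).symm) hez')
      (krylov_transpose_mulVec_eq_zero hA hAz hez' hc hw)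
  obtain ⟨u, ⟨cu, hu⟩, heu⟩ := exists_mulVec_mem_span_and_dotProduct_one hA hz0 hAz hzz' hK
  obtain ⟨x, d, hx⟩ := one_mem_range_mulVec_add_span hA hz0 hAz hzz' hK
  choose β hβ using hSz
  obtain ⟨γ, hγ⟩ := hez
  have hzβ : zp ⬝ᵥ (fun i => (β i : ZMod p)) = 0 := by
    have h1 : z ⬝ᵥ (S *ᵥ z) = 0 := by
      have := dotProduct_mulVec_of_skew hS z z
      rw [dotProduct_comm (S *ᵥ z)] at this
      linarith
    have h2 : z ⬝ᵥ β = 0 := by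
      -- Write `S z = p β` and `e ⬝ z = p γ`. Skewness gives `z ⬝ S z = 0` over the integers, hence
      -- `z ⬝ β = 0`, the condition for solving `β = A y + c e` modulo `p`.
      have h3 : S *ᵥ z = (p : ℤ) • β := funext hβ
      rw [h3, dotProduct_smul, smul_eq_mul] at h1
      exact (mul_eq_zero.1 h1).resolve_left hp0
    have := congrArg (Int.cast : ℤ → ZMod p) h2
    simpa [dotProduct] using this
  obtain ⟨y, c, hy⟩ := exists_eq_mulVec_add_smul_of_dotProduct_eq_zero hA
    (fun w hw => hK w ⟨0, by rw [hw, zero_smul]⟩) _ hzβ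
  -- correct `z` by a multiple of `p`
  set t : ZMod p := ((γ : ZMod p) - 1 ⬝ᵥ (y + c • x)) / (1 ⬝ᵥ u) with ht
  obtain ⟨Y, hY⟩ : ∃ Y : Fin n → ℤ, (fun i => (Y i : ZMod p)) = y + c • x + t • u :=
    ⟨fun i => ((y + c • x + t • u) i).val, by ext i; simp⟩
  -- Since `e = A x + d z` and `A u = cu z`, this is the coefficient in `β - A Y = r z` modulo `p`.
  obtain ⟨r, hr⟩ : ∃ r : ℤ, (r : ZMod p) = c * d - t * cu := ⟨(c * d - t * cu).val, by simp⟩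
  have heY : (p : ℤ) ∣ γ - 1 ⬝ᵥ Y := by
    rw [← ZMod.intCast_zmod_eq_zero_iff_dvd]
    have h1 : ((1 ⬝ᵥ Y : ℤ) : ZMod p) = 1 ⬝ᵥ (y + c • x + t • u) := by
      rw [← hY]; simp [dotProduct]
    rw [Int.cast_sub, h1, dotProduct_add _ _ (t • u), dotProduct_smul, smul_eq_mul, ht,
      div_mul_cancel₀ _ heu]
    ring
  have hSY : ∀ i, (p : ℤ) ∣ β i - (S *ᵥ Y) i - r * z i := by
    intro i
    rw [← ZMod.intCast_zmod_eq_zero_iff_dvd]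
    push_cast
    rw [← map_mulVec_intCast, hY, hr, mulVec_add, mulVec_add, mulVec_smul, mulVec_smul, hu]
    have h1 := congrFun hy i
    have h2 := congrFun hx i
    simp only [Pi.add_apply, Pi.smul_apply, smul_eq_mul, Pi.one_apply] at h1 h2 ⊢
    rw [h1, ← hAdef]
    simp only [hzp] at h2 ⊢
    linear_combination c * h2
  -- Over `ZMod (p ^ 2)` the kernel vector is `p z`: both `S (p z) = p ^ 2 β` and `e ⬝ p z = p ^ 2
  -- γ` vanish, while `S (z - p Y) = p (β - S Y)` is `r` times `p z`.
  have hz'' : (krylov (S.map (Int.cast : ℤ → ZMod (p ^ 2))))ᵀ *ᵥ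
      (fun i => ((z i - p * Y i : ℤ) : ZMod (p ^ 2))) = 0 := by
    refine krylov_transpose_mulVec_eq_zero (transpose_map_intCast_of_skew _ hS)
      (z := fun i => ((p * z i : ℤ) : ZMod (p ^ 2))) (c := r) ?_ ?_ ?_ ?_
    · ext i
      rw [map_mulVec_intCast, Pi.zero_apply, ZMod.intCast_zmod_eq_zero_iff_dvd]
      have h3 : S *ᵥ (fun i => p * z i) = (p : ℤ) • (p : ℤ) • β := by
        rw [← (funext hβ : S *ᵥ z = (p : ℤ) • β), ← mulVec_smul]; rfl
      rw [h3]
      exact ⟨β i, by simp; ring⟩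
    · have h3 : (1 : Fin n → ZMod (p ^ 2)) ⬝ᵥ (fun i => ((p * z i : ℤ) : ZMod (p ^ 2))) =
          ((p * (1 ⬝ᵥ z) : ℤ) : ZMod (p ^ 2)) := by
        simp [dotProduct, Finset.mul_sum]
      rw [h3, ZMod.intCast_zmod_eq_zero_iff_dvd, hγ]
      exact ⟨γ, by push_cast; ring⟩
    · ext i
      rw [map_mulVec_intCast, Pi.smul_apply, smul_eq_mul, ← Int.cast_mul, ← sub_eq_zero,
        ← Int.cast_sub, ZMod.intCast_zmod_eq_zero_iff_dvd]
      have h3 : S *ᵥ (fun i => z i - p * Y i) = (p : ℤ) • β - (p : ℤ) • (S *ᵥ Y) := by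
        rw [← (funext hβ : S *ᵥ z = (p : ℤ) • β), ← mulVec_smul, ← mulVec_sub]; rfl
      rw [h3]
      obtain ⟨k, hk⟩ := hSY i
      refine ⟨k, ?_⟩
      simp only [Pi.sub_apply, Pi.smul_apply, smul_eq_mul]
      push_cast
      linear_combination (p : ℤ) * hk
    · have h3 : (1 : Fin n → ZMod (p ^ 2)) ⬝ᵥ (fun i => ((z i - p * Y i : ℤ) : ZMod (p ^ 2))) =
          ((1 ⬝ᵥ z - p * (1 ⬝ᵥ Y) : ℤ) : ZMod (p ^ 2)) := by
        simp [dotProduct, Finset.mul_sum]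
      rw [h3, ZMod.intCast_zmod_eq_zero_iff_dvd, hγ]
      obtain ⟨k, hk⟩ := heY
      exact ⟨k, by push_cast; linear_combination (p : ℤ) * hk⟩
  apply hz0
  ext i
  by_contra hi
  rw [Pi.zero_apply, hzp, ZMod.intCast_zmod_eq_zero_iff_dvd] at hi
  apply hdet
  -- The adjugate gives `det W * (z i - p Y i) ≡ 0` modulo `p ^ 2`, and the second factor is prime
  -- to `p` for an index with `p ∤ z i`.
  have h4 := congrArg (fun v => (adjugate (krylov (S.map (Int.cast : ℤ → ZMod (p ^ 2))))ᵀ *ᵥ v) i)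
    hz''
  simp only [mulVec_mulVec, adjugate_mul, smul_mulVec, one_mulVec, mulVec_zero, Pi.zero_apply,
    Pi.smul_apply, smul_eq_mul, det_transpose] at h4
  have h5 : (krylov (S.map (Int.cast : ℤ → ZMod (p ^ 2)))).det =
      ((krylov S).det : ZMod (p ^ 2)) := by
    rw [krylov_map_intCast]
    exact (RingHom.map_det (Int.castRingHom (ZMod (p ^ 2))) _).symm
  rw [h5, ← Int.cast_mul, ZMod.intCast_zmod_eq_zero_iff_dvd, Nat.cast_pow] at h4
  refine IsCoprime.dvd_of_dvd_mul_right (IsCoprime.pow_left ?_) h4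
  refine ((Nat.prime_iff_prime_int.1 Fact.out).coprime_iff_not_dvd).2 fun h => hi ?_
  have := dvd_add h (dvd_mul_right (p : ℤ) (Y i))
  simpa using this

/-! ### The prime 2: parity of moments and the Gram matrix -/

theorem moment_eq_zero_of_odd {V : Type*} [Fintype V] [DecidableEq V] {S : Matrix V V ℤ}
    (hS : Sᵀ = -S) {k : ℕ} (hk : Odd k) : moment S k = 0 := by
  have h := pow_mulVec_one_dotProduct_of_skew hS k 1
  rw [dotProduct_comm, hk.neg_one_pow] at h
  unfold moment
  linarith

/-- Up to sign, the moment of index `2 j` is the sum of the squares of the entries of `S ^ j e`, and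
`a ^ 2 ≡ a` modulo `2` reduces it to index `j`. Odd moments vanish. -/
theorem even_moment {V : Type*} [Fintype V] [DecidableEq V] {S : Matrix V V ℤ} (hS : Sᵀ = -S) :
    ∀ k, k ≠ 0 → Even (moment S k) := by
  intro k
  induction k using Nat.strong_induction_on with
  | _ k ih =>
    intro hk
    rcases Nat.even_or_odd' k with ⟨j, rfl | rfl⟩
    · have h1 := pow_mulVec_dotProduct_of_skew hS j j 1 1
      have h2 : moment S (2 * j) = (-1) ^ j * (((S ^ j) *ᵥ 1) ⬝ᵥ ((S ^ j) *ᵥ 1)) := by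
        rw [h1, ← mul_assoc, ← mul_pow, two_mul]
        simp [moment]
      have h3 : Even (((S ^ j) *ᵥ 1) ⬝ᵥ ((S ^ j) *ᵥ 1) - moment S j) := by
        rw [moment, ← sub_dotProduct, dotProduct]
        refine Finset.even_sum _ fun i _ => ?_
        rw [Pi.sub_apply, Pi.one_apply, mul_comm]
        exact Int.even_mul_pred_self _
      have h4 := h3.add (ih j (by omega) (by omega))
      rw [sub_add_cancel] at h4
      rw [h2]
      exact h4.mul_left _
    · rw [moment_eq_zero_of_odd hS ⟨j, rfl⟩]
      exact Even.zero

theorem even_moment_of_even_or {n : ℕ} {S : Matrix (Fin n) (Fin n) ℤ} (hS : Sᵀ = -S) {k : ℕ}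
    (h : Even n ∨ k ≠ 0) : Even (moment S k) := by
  by_cases hk : k = 0
  · subst hk
    have hn := h.resolve_right (by simp)
    simpa [moment] using hn
  · exact even_moment hS k hk

/-- Off-diagonal terms come in equal pairs of even numbers. -/
theorem four_dvd_sum_sum_sub_sum_diag {ι : Type*} (s : Finset ι) (g : ι → ι → ℤ)
    (hsymm : ∀ a b, g a b = g b a) (heven : ∀ a b, 2 ∣ g a b) :
    4 ∣ ∑ a ∈ s, ∑ b ∈ s, g a b - ∑ a ∈ s, g a a := by
  classical
  induction s using Finset.induction_on with
  | empty => simp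
  | insert c s hc ih =>
    simp only [Finset.sum_insert hc, Finset.sum_add_distrib]
    have h1 : ∑ a ∈ s, g a c = ∑ b ∈ s, g c b := Finset.sum_congr rfl fun a _ => hsymm a c
    obtain ⟨k, hk⟩ := Finset.dvd_sum fun b (_ : b ∈ s) => heven c b
    obtain ⟨l, hl⟩ := ih
    rw [h1, hk]
    exact ⟨k + l, by linear_combination hl⟩

theorem dvd_det_mul_of_dvd_mulVec {V R : Type*} [Fintype V] [DecidableEq V] [CommRing R]
    (M : Matrix V V R) {q : R} {y : V → R} (h : ∀ i, q ∣ (M *ᵥ y) i) (i : V) :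
    q ∣ M.det * y i := by
  have h1 : (M.adjugate *ᵥ (M *ᵥ y)) i = M.det * y i := by
    rw [mulVec_mulVec, adjugate_mul, smul_mulVec, one_mulVec]; rfl
  rw [← h1]
  exact Finset.dvd_sum fun j _ => (h j).mul_left _

theorem prod_ite_zero_one_two (n : ℕ) :
    ∏ j : Fin n, (if (j : ℕ) = 0 ∧ n % 2 = 1 then 1 else 2 : ℤ) = 2 ^ (2 * (n / 2)) := by
  rcases Nat.even_or_odd' n with ⟨k, rfl | rfl⟩
  · simp
  · rw [Fin.prod_univ_succ]
    have : (2 * k + 1) / 2 = k := by omega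
    simp [this]

/-- If `2 ^ (-⌊n/2⌋) det W` is odd, then `WᵀW` is, up to halving its even columns, invertible
modulo `2`. -/
theorem two_dvd_of_four_dvd_gram_mulVec {n : ℕ} {S : Matrix (Fin n) (Fin n) ℤ} (hS : Sᵀ = -S)
    {m : ℤ} (hm : Odd m) (hdet : (krylov S).det = 2 ^ (n / 2) * m) {x : Fin n → ℤ}
    (hx : ∀ i, 4 ∣ (((krylov S)ᵀ * krylov S) *ᵥ x) i) (j : Fin n) : 2 ∣ x j := by
  -- The only entry of `Wᵀ W` that can be odd is the corner, which equals `n`. Halving the other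
  -- columns removes `2 ^ (2 * (n / 2))`, exactly the power of `2` in `(det W) ^ 2`.
  set D : Fin n → ℤ := fun j => if (j : ℕ) = 0 ∧ n % 2 = 1 then 1 else 2 with hD
  have hdvd : ∀ i j, D j ∣ ((krylov S)ᵀ * krylov S) i j := by
    intro i j
    rw [gram_krylov hS, hD]
    dsimp only
    split_ifs with h
    · exact one_dvd _
    · refine Dvd.dvd.mul_left (even_iff_two_dvd.1 (even_moment_of_even_or hS ?_)) _
      rw [Nat.even_iff]
      omega
  choose N hN using hdvd
  have hG : (krylov S)ᵀ * krylov S = Matrix.of N * Matrix.diagonal D := by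
    ext i j
    rw [Matrix.mul_diagonal, hN, mul_comm, Matrix.of_apply]
  have hNdet : (Matrix.of N).det = m ^ 2 := by
    have h := congrArg Matrix.det hG
    rw [det_mul, det_mul, det_transpose, det_diagonal, prod_ite_zero_one_two, hdet] at h
    have h2 : (2 : ℤ) ^ (2 * (n / 2)) ≠ 0 := by positivity
    refine mul_right_cancel₀ h2 ?_
    rw [← h, two_mul, pow_add]
    ring
  rw [hG] at hx
  have h1 := dvd_det_mul_of_dvd_mulVec (Matrix.of N) (y := Matrix.diagonal D *ᵥ x) (q := 4)
    (fun i => by rw [mulVec_mulVec]; exact hx i) j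
  rw [hNdet, mulVec_diagonal] at h1
  have h4 : IsCoprime (4 : ℤ) (m ^ 2) := by
    have : IsCoprime (2 : ℤ) m := Int.isCoprime_two_left.2 hm
    exact (this.pow : IsCoprime ((2 : ℤ) ^ 2) (m ^ 2))
  have h5 := h4.dvd_of_dvd_mul_left h1
  simp only [hD] at h5
  split_ifs at h5 <;> omega

/-! ### The prime 2: the kernel of the transposed walk matrix -/

section HalfBasis

variable {n : ℕ} {S : Matrix (Fin n) (Fin n) ℤ}

/-- The combinations of the vectors `S ^ i e` with `0 ≤ 2 i < n`, and `i ≠ 0` if `n` is odd. -/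
def halfComb {R : Type*} [CommRing R] (A : Matrix (Fin n) (Fin n) R) (x : Fin (n / 2) → R) :
    Fin n → R :=
  ∑ a, x a • ((A ^ ((a : ℕ) + n % 2)) *ᵥ 1)

theorem halfComb_dotProduct (hS : Sᵀ = -S) (x : Fin (n / 2) → ℤ) (k : ℕ) :
    halfComb S x ⬝ᵥ ((S ^ k) *ᵥ halfComb S x) =
      ∑ a, ∑ b, x a * x b * ((-1) ^ ((a : ℕ) + n % 2) *
        moment S ((a : ℕ) + n % 2 + (k + (b + n % 2)))) := by
  rw [halfComb, sum_dotProduct]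
  refine Finset.sum_congr rfl fun a _ => ?_
  rw [mulVec_sum, dotProduct_sum]
  refine Finset.sum_congr rfl fun b _ => ?_
  rw [mulVec_smul, smul_dotProduct, dotProduct_smul, smul_eq_mul, smul_eq_mul, mulVec_mulVec,
    ← pow_add, pow_mulVec_dotProduct_of_skew hS, moment]
  ring

/-- For even `k` the form `S ^ k` is symmetric, so `2 β` does not matter modulo `4`. All moments
involved are even, so off-diagonal terms pair up to multiples of `4`, and `x a ^ 2` may be replaced
by `x a`: a quadratic condition becomes linear. For odd `k` every moment is zero. -/
theorem four_dvd_sum_moment (hS : Sᵀ = -S) {x : Fin (n / 2) → ℤ} {β : Fin n → ℤ}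
    (h : ∀ k, 4 ∣ (halfComb S x + (2 : ℤ) • β) ⬝ᵥ ((S ^ k) *ᵥ (halfComb S x + (2 : ℤ) • β)))
    (k : ℕ) :
    4 ∣ ∑ a : Fin (n / 2), x a * ((-1) ^ ((a : ℕ) + n % 2) * moment S (k + 2 * (a + n % 2))) := by
  rcases Nat.even_or_odd k with hk | hk
  swap
  · rw [Finset.sum_eq_zero]
    · exact dvd_zero 4
    · intro a _
      rw [moment_eq_zero_of_odd hS (hk.add_even (even_two_mul _)), mul_zero, mul_zero]
  have heven : ∀ a b : Fin (n / 2), Even (moment S ((a : ℕ) + n % 2 + (k + (b + n % 2)))) := by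
    intro a b
    apply even_moment_of_even_or hS
    rw [Nat.even_iff]
    omega
  have h1 : 4 ∣ halfComb S x ⬝ᵥ ((S ^ k) *ᵥ halfComb S x) := by
    have h2 := h k
    set f := halfComb S x
    have h3 : β ⬝ᵥ ((S ^ k) *ᵥ f) = f ⬝ᵥ ((S ^ k) *ᵥ β) := by
      have := pow_mulVec_dotProduct_of_skew hS k 0 f β
      rw [hk.neg_one_pow, one_mul, dotProduct_comm] at this
      simpa using this
    simp only [mulVec_add, dotProduct_add, add_dotProduct, mulVec_smul, smul_dotProduct,
      dotProduct_smul, smul_eq_mul, h3] at h2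
    omega
  rw [halfComb_dotProduct hS] at h1
  have h2 := four_dvd_sum_sum_sub_sum_diag Finset.univ (fun a b : Fin (n / 2) =>
    x a * x b * ((-1) ^ ((a : ℕ) + n % 2) * moment S ((a : ℕ) + n % 2 + (k + (b + n % 2))))) (by
      intro a b
      have hi : (a : ℕ) + n % 2 + (k + (b + n % 2)) = b + n % 2 + (k + (a + n % 2)) := by ring
      rw [hi]
      rcases Nat.even_or_odd ((a : ℕ) + b) with hab | hab
      · have : (-1 : ℤ) ^ ((a : ℕ) + n % 2) = (-1) ^ ((b : ℕ) + n % 2) := by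
          rw [pow_add, pow_add, neg_one_pow_eq_pow_mod_two, neg_one_pow_eq_pow_mod_two (b : ℕ)]
          rw [Nat.even_iff] at hab
          rw [show (a : ℕ) % 2 = b % 2 by omega]
        rw [this]
        ring
      · rw [moment_eq_zero_of_odd hS]
        · ring
        · rw [Nat.odd_iff] at *
          rw [Nat.even_iff] at hk
          omega)
    (fun a b => ((even_iff_two_dvd.1 (heven a b)).mul_left _).mul_left _)
  have h3 := (Int.dvd_iff_dvd_of_dvd_sub h2).1 h1
  have h4 : 4 ∣ ∑ a : Fin (n / 2), (x a * x a *
        ((-1) ^ ((a : ℕ) + n % 2) * moment S ((a : ℕ) + n % 2 + (k + (a + n % 2)))) -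
      x a * ((-1) ^ ((a : ℕ) + n % 2) * moment S (k + 2 * (a + n % 2)))) := by
    refine Finset.dvd_sum fun a _ => ?_
    have hi : (a : ℕ) + n % 2 + (k + (a + n % 2)) = k + 2 * (a + n % 2) := by ring
    obtain ⟨c, hc⟩ := even_iff_two_dvd.1 (heven a a)
    obtain ⟨d, hd⟩ := even_iff_two_dvd.1 (Int.even_mul_pred_self (x a))
    rw [← hi, hc]
    exact ⟨d * (-1) ^ ((a : ℕ) + n % 2) * c, by
      linear_combination (-1) ^ ((a : ℕ) + n % 2) * (2 * c) * hd⟩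
  rw [Finset.sum_sub_distrib] at h4
  exact (Int.dvd_iff_dvd_of_dvd_sub h4).1 h3

theorem two_dvd_of_four_dvd_halfComb (hS : Sᵀ = -S) {m : ℤ} (hm : Odd m)
    (hdet : (krylov S).det = 2 ^ (n / 2) * m) {x : Fin (n / 2) → ℤ} {β : Fin n → ℤ}
    (h : ∀ k, 4 ∣ (halfComb S x + (2 : ℤ) • β) ⬝ᵥ ((S ^ k) *ᵥ (halfComb S x + (2 : ℤ) • β)))
    (a : Fin (n / 2)) : 2 ∣ x a := by
  -- The linear conditions say that `4` divides `Wᵀ W X`, where `X` carries the signed `x a` at the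
  -- positions `2 (a + n % 2)`, all smaller than `n`.
  let ix : Fin (n / 2) → Fin n := fun a => ⟨2 * (a + n % 2), by omega⟩
  have hix : ∀ a b, ix a = ix b ↔ a = b := fun a b => by
    simp only [ix, Fin.ext_iff]; omega
  let X : Fin n → ℤ := ∑ a, Pi.single (ix a) ((-1) ^ ((a : ℕ) + n % 2) * x a)
  have hX : ∀ i, 4 ∣ (((krylov S)ᵀ * krylov S) *ᵥ X) i := by
    intro i
    have h1 : (((krylov S)ᵀ * krylov S) *ᵥ X) i = (-1) ^ (i : ℕ) * ∑ a : Fin (n / 2), x a *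
        ((-1) ^ ((a : ℕ) + n % 2) * moment S (i + 2 * (a + n % 2))) := by
      simp only [X, mulVec_sum, Finset.sum_apply, mulVec_single, Finset.mul_sum]
      refine Finset.sum_congr rfl fun a _ => ?_
      simp only [Pi.smul_apply, MulOpposite.smul_eq_mul_unop, MulOpposite.unop_op, col_apply,
        gram_krylov hS, ix]
      ring
    rw [h1]
    exact (four_dvd_sum_moment hS h i).mul_left _
  have h2 := two_dvd_of_four_dvd_gram_mulVec hS hm hdet hX (ix a)
  have h3 : X (ix a) = (-1) ^ ((a : ℕ) + n % 2) * x a := by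
    simp [X, Finset.sum_apply, Pi.single_apply, hix]
  rw [h3] at h2
  rcases neg_one_pow_eq_or ℤ ((a : ℕ) + n % 2) with h4 | h4 <;> rw [h4] at h2 <;> omega

/-- If `2 ^ (-⌊n/2⌋) det W` is odd, then an integral vector `u` with `Wᵀ u ≡ 0` modulo `2` and
`uᵀ S ^ k u ≡ 0` modulo `4` for all `k` vanishes modulo `2`. -/
theorem two_dvd_of_krylov_transpose_mulVec (hS : Sᵀ = -S) {m : ℤ} (hm : Odd m)
    (hdet : (krylov S).det = 2 ^ (n / 2) * m) {u : Fin n → ℤ}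
    (hW : ∀ i, 2 ∣ ((krylov S)ᵀ *ᵥ u) i) (hu : ∀ k, 4 ∣ u ⬝ᵥ ((S ^ k) *ᵥ u)) (i : Fin n) :
    2 ∣ u i := by
  let v : Fin (n / 2) → Fin n → ZMod 2 := fun a j => (((S ^ ((a : ℕ) + n % 2)) *ᵥ 1) j : ℤ)
  -- Used twice: `w = 0` gives linear independence of `v`, and `w = u` gives the conclusion.
  have hlift : ∀ (c : Fin (n / 2) → ZMod 2) (w : Fin n → ℤ),
      ∑ a, c a • v a = (fun j => (w j : ZMod 2)) → (∀ k, 4 ∣ w ⬝ᵥ ((S ^ k) *ᵥ w)) → c = 0 := by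
    intro c w hc hw
    have h1 : ∀ j, (2 : ℤ) ∣ (w - halfComb S fun a => ((c a).val : ℤ)) j := by
      intro j
      have h2 := congrFun hc j
      rw [← Nat.cast_two, ← ZMod.intCast_zmod_eq_zero_iff_dvd, Pi.sub_apply, Int.cast_sub, ← h2,
        sub_eq_zero]
      rw [halfComb, Finset.sum_apply, Finset.sum_apply, Int.cast_sum]
      refine Finset.sum_congr rfl fun a _ => ?_
      simp only [v, Pi.smul_apply, smul_eq_mul, Int.cast_mul, Int.cast_natCast,
        ZMod.natCast_zmod_val]
    choose β hβ using h1
    have h3 : halfComb S (fun a => ((c a).val : ℤ)) + (2 : ℤ) • β = w := by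
      rw [← (funext hβ : (w - halfComb S fun a => ((c a).val : ℤ)) = (2 : ℤ) • β)]
      abel
    ext a
    have h4 := two_dvd_of_four_dvd_halfComb hS hm hdet (by rw [h3]; exact hw) a
    have h5 := (ZMod.intCast_zmod_eq_zero_iff_dvd _ 2).2 h4
    simpa using h5
  have hli : LinearIndependent (ZMod 2) v := by
    rw [Fintype.linearIndependent_iff]
    intro g hg a
    exact congrFun (hlift g 0 (by rw [hg]; ext; simp) (by simp)) a
  have hmem : (fun j => (u j : ZMod 2)) ∈ Submodule.span (ZMod 2) (Set.range v) := by
    by_contra hmem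
    -- With `u` outside the span there would be `n / 2 + 1` independent kernel vectors, one more
    -- than the power of `2` in `det W` allows.
    have hli2 := linearIndependent_finCons.2 ⟨hli, hmem⟩
    have hp := prime_pow_card_dvd_det 2 (krylov S)ᵀ _ hli2 (by
      intro a
      ext i
      refine Fin.cases ?_ (fun a => ?_) a
      · rw [Fin.cons_zero, map_mulVec_intCast, Pi.zero_apply, ZMod.intCast_zmod_eq_zero_iff_dvd]
        exact hW i
      · rw [Fin.cons_succ, map_mulVec_intCast, Pi.zero_apply, ZMod.intCast_zmod_eq_zero_iff_dvd,
          krylov_transpose_mulVec, pow_mulVec_dotProduct_of_skew hS]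
        refine Dvd.dvd.mul_left (even_iff_two_dvd.1 (even_moment_of_even_or hS ?_)) _
        rw [Nat.even_iff]
        omega)
    rw [Fintype.card_fin, det_transpose, hdet, pow_succ] at hp
    have h2 : (2 : ℤ) ^ (n / 2) ≠ 0 := by positivity
    have h3 := Int.dvd_of_mul_dvd_mul_left h2 hp
    exact (Int.not_even_iff_odd.2 hm) (even_iff_two_dvd.2 h3)
  obtain ⟨c, hc⟩ := (Submodule.mem_span_range_iff_exists_fun _).1 hmem
  have h0 := hlift c u hc hu
  rw [h0] at hc
  have h1 := congrFun hc i
  simp only [Pi.zero_apply, zero_smul, Finset.sum_const_zero] at h1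
  exact (ZMod.intCast_zmod_eq_zero_iff_dvd _ 2).1 h1.symm

end HalfBasis

theorem det_map_intCast {V : Type*} [Fintype V] [DecidableEq V] (R : Type*) [CommRing R]
    (A : Matrix V V ℤ) : (A.map (Int.cast : ℤ → R)).det = (A.det : R) :=
  (RingHom.map_det (Int.castRingHom R) A).symm

theorem map_intCast_mul {V : Type*} [Fintype V] (R : Type*) [CommRing R] (A B : Matrix V V ℤ) :
    (A * B).map (Int.cast : ℤ → R) = A.map (Int.cast : ℤ → R) * B.map (Int.cast : ℤ → R) :=
  Matrix.map_mul (f := Int.castRingHom R)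

theorem map_intCast_pow {V : Type*} [Fintype V] [DecidableEq V] (R : Type*) [CommRing R]
    (A : Matrix V V ℤ) (k : ℕ) :
    (A ^ k).map (Int.cast : ℤ → R) = A.map (Int.cast : ℤ → R) ^ k :=
  map_pow (Int.castRingHom R).mapMatrix A k

theorem map_intCast_zsmul {V : Type*} (R : Type*) [CommRing R] (c : ℤ) (A : Matrix V V ℤ) :
    (c • A).map (Int.cast : ℤ → R) = (c : R) • A.map (Int.cast : ℤ → R) := by
  ext i j
  simp only [Matrix.smul_apply, Matrix.map_apply, smul_eq_mul, Int.cast_mul]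

theorem moment_map_intCast {V : Type*} [Fintype V] [DecidableEq V] (R : Type*) [CommRing R]
    (A : Matrix V V ℤ) (k : ℕ) : moment (A.map (Int.cast : ℤ → R)) k = ((moment A k : ℤ) : R) :=
  moment_map (Int.castRingHom R) A k

/-! ### Spectra and transition matrices of oriented graphs -/

namespace OrientedGraph

variable {V : Type*}

theorem skewAdj_transpose (G : OrientedGraph V) : G.skewAdjᵀ = -G.skewAdj := by
  ext u v
  have h := G.asymm u v
  simp only [skewAdj, transpose_apply, Matrix.neg_apply, Matrix.of_apply]
  split_ifs <;> simp_all

theorem skewAdj_converse (G : OrientedGraph V) : G.converse.skewAdj = G.skewAdjᵀ := by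
  rfl

theorem skewAdj_eq_one_iff (G : OrientedGraph V) (u v : V) : G.skewAdj u v = 1 ↔ G.Adj u v := by
  simp only [skewAdj, Matrix.of_apply]
  split_ifs <;> simp_all

section Spectrum

variable [Fintype V] [DecidableEq V]

theorem charpoly_eq_of_spec_eq {A B : Matrix V V ℤ} (h : spec A = spec B) :
    A.charpoly = B.charpoly := by
  have key : ∀ A : Matrix V V ℤ, A.charpoly.map (Int.castRingHom ℂ) =
      ((spec A).map fun a => Polynomial.X - Polynomial.C a).prod := by
    intro A
    rw [← charpoly_map]
    exact (IsAlgClosed.splits _).eq_prod_roots_of_monic (charpoly_monic _)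
  apply Polynomial.map_injective (Int.castRingHom ℂ) Int.cast_injective
  rw [key, key, h]

/-- Transposition turns `J - 1 - A` into `A + J - 1`, and subtracting `1` only translates the
characteristic polynomial. -/
theorem charpoly_add_ones_eq {A B : Matrix V V ℤ} (hA : Aᵀ = -A) (hB : Bᵀ = -B)
    (h : (Matrix.of (fun _ _ => (1 : ℤ)) - 1 - A).charpoly =
      (Matrix.of (fun _ _ => (1 : ℤ)) - 1 - B).charpoly) :
    (A + Matrix.of fun _ _ => (1 : ℤ)).charpoly = (B + Matrix.of fun _ _ => (1 : ℤ)).charpoly := by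
  have key : ∀ A : Matrix V V ℤ, Aᵀ = -A → (Matrix.of (fun _ _ => (1 : ℤ)) - 1 - A).charpoly =
      (A + Matrix.of fun _ _ => (1 : ℤ)).charpoly.comp (Polynomial.X + Polynomial.C 1) := by
    intro A hA
    rw [← charpoly_sub_scalar, ← charpoly_transpose]
    congr 1
    rw [transpose_sub, transpose_sub, hA, transpose_one, map_one, sub_neg_eq_add]
    have : (Matrix.of (fun _ _ => (1 : ℤ)) : Matrix V V ℤ)ᵀ = Matrix.of (fun _ _ => (1 : ℤ)) := rfl
    rw [this]
    abel
  rw [key A hA, key B hB] at h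
  have h2 := congrArg (fun q => q.comp (Polynomial.X - Polynomial.C (1 : ℤ))) h
  simpa [Polynomial.comp_assoc] using h2

theorem genSkewSpec_converse (G : OrientedGraph V) : G.converse.genSkewSpec = G.genSkewSpec := by
  have h : ∀ A : Matrix V V ℤ, spec Aᵀ = spec A := fun A => by
    rw [spec, spec, transpose_map, charpoly_transpose]
  have h2 : Matrix.of (fun _ _ => (1 : ℤ)) - 1 - G.skewAdjᵀ =
      (Matrix.of (fun _ _ => (1 : ℤ)) - 1 - G.skewAdj)ᵀ := by
    rw [transpose_sub, transpose_sub, transpose_one]; rfl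
  rw [genSkewSpec, genSkewSpec, skewAdj_converse, h, h2, h]

end Spectrum

section Transition

variable {n : ℕ} {G H : OrientedGraph (Fin n)} {Q : Matrix (Fin n) (Fin n) ℚ}

theorem nonempty_transition (hdet : G.skewWalk.det ≠ 0) (h : H.genSkewSpec = G.genSkewSpec) :
    (transition G H).Nonempty := by
  have h1 := charpoly_eq_of_spec_eq (congrArg Prod.fst h)
  have h2 := charpoly_add_ones_eq H.skewAdj_transpose G.skewAdj_transpose
    (charpoly_eq_of_spec_eq (congrArg Prod.snd h))
  obtain ⟨Q, hQ, hQe, hQS⟩ := exists_orthogonal_of_moment_eq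
    (transpose_map_intCast_of_skew ℚ G.skewAdj_transpose)
    (transpose_map_intCast_of_skew ℚ H.skewAdj_transpose)
    (fun k => by
      rw [moment_map_intCast, moment_map_intCast, moment_eq_of_charpoly_eq h1 h2])
    (by
      rw [krylov_map_intCast, det_map_intCast]
      exact Int.cast_ne_zero.2 hdet)
  exact ⟨Q, ⟨(mem_orthogonalGroup_iff' _ _).2 hQ, hQe⟩, hQS⟩

theorem transpose_mul_self_of_mem_transition (hQ : Q ∈ transition G H) : Qᵀ * Q = 1 :=
  (mem_orthogonalGroup_iff' _ _).1 hQ.1.1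

theorem mul_transpose_self_of_mem_transition (hQ : Q ∈ transition G H) : Q * Qᵀ = 1 :=
  (mem_orthogonalGroup_iff _ _).1 hQ.1.1

theorem transpose_mul_pow_mul_of_mem_transition (hQ : Q ∈ transition G H) (k : ℕ) :
    Qᵀ * G.skewAdj.map (Int.cast : ℤ → ℚ) ^ k * Q = H.skewAdj.map (Int.cast : ℤ → ℚ) ^ k := by
  induction k with
  | zero => simpa using transpose_mul_self_of_mem_transition hQ
  | succ k ih =>
    rw [pow_succ, pow_succ, ← ih, ← hQ.2]
    simp only [Matrix.mul_assoc]
    rw [← Matrix.mul_assoc Q, mul_transpose_self_of_mem_transition hQ, Matrix.one_mul]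

theorem transpose_mulVec_pow_of_mem_transition (hQ : Q ∈ transition G H) (k : ℕ) :
    Qᵀ *ᵥ (G.skewAdj.map (Int.cast : ℤ → ℚ) ^ k *ᵥ 1) =
      H.skewAdj.map (Int.cast : ℤ → ℚ) ^ k *ᵥ 1 := by
  rw [← transpose_mul_pow_mul_of_mem_transition hQ, ← mulVec_mulVec, ← mulVec_mulVec, hQ.1.2]

theorem transpose_mul_skewWalk_of_mem_transition (hQ : Q ∈ transition G H) :
    Qᵀ * G.skewWalk.map (Int.cast : ℤ → ℚ) = H.skewWalk.map (Int.cast : ℤ → ℚ) := by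
  have h : ∀ G : OrientedGraph (Fin n), G.skewWalk.map (Int.cast : ℤ → ℚ) =
      krylov (G.skewAdj.map (Int.cast : ℤ → ℚ)) := fun G => (krylov_map_intCast ℚ _).symm
  rw [h, h]
  ext i j
  exact congrFun (transpose_mulVec_pow_of_mem_transition hQ j) i

theorem transition_subsingleton (hdet : G.skewWalk.det ≠ 0) {Q Q' : Matrix (Fin n) (Fin n) ℚ}
    (hQ : Q ∈ transition G H) (hQ' : Q' ∈ transition G H) : Q = Q' := by
  have hu : IsUnit (G.skewWalk.map (Int.cast : ℤ → ℚ)) := by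
    rw [Matrix.isUnit_iff_isUnit_det, det_map_intCast]
    exact IsUnit.mk0 _ (Int.cast_ne_zero.2 hdet)
  apply transpose_injective
  apply hu.mul_right_cancel
  rw [transpose_mul_skewWalk_of_mem_transition hQ, transpose_mul_skewWalk_of_mem_transition hQ']

end Transition

/-! ### The level of a transition matrix -/

section Level

variable {n : ℕ} {Q : Matrix (Fin n) (Fin n) ℚ}

/-- The integers `k` with `k Q` integral form a subgroup of `ℤ`; a nonzero remainder modulo the
level would be a smaller positive member. -/
theorem level_dvd {k : ℤ} {M : Matrix (Fin n) (Fin n) ℤ}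
    (h : (k : ℚ) • Q = M.map (Int.cast : ℤ → ℚ)) : (level Q : ℤ) ∣ k := by
  obtain ⟨hpos, L, hL⟩ := level_spec Q
  have hpos' : (0 : ℤ) < level Q := by exact_mod_cast hpos
  rw [Int.dvd_iff_emod_eq_zero]
  by_contra hr
  have hr0 : 0 ≤ k % level Q := Int.emod_nonneg _ hpos'.ne'
  have hrl := Int.emod_lt_of_pos k hpos'
  have hmem : (k % level Q).toNat ∈ {k : ℕ | 0 < k ∧ ∃ M : Matrix (Fin n) (Fin n) ℤ,
      (k : ℚ) • Q = M.map (Int.cast : ℤ → ℚ)} := by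
    refine ⟨by omega, M - (k / level Q) • L, ?_⟩
    have h1 : (((k % level Q).toNat : ℕ) : ℚ) = k - level Q * (k / level Q : ℤ) := by
      have h2 : (((k % level Q).toNat : ℕ) : ℤ) = k - level Q * (k / level Q) := by
        rw [Int.toNat_of_nonneg hr0, Int.emod_def]
      exact_mod_cast congrArg (Int.cast : ℤ → ℚ) h2
    ext i j
    have h3 := congrFun (congrFun h i) j
    have h4 := congrFun (congrFun hL i) j
    simp only [Matrix.smul_apply, smul_eq_mul, Matrix.map_apply, Matrix.sub_apply] at h3 h4 ⊢
    rw [h1]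
    push_cast
    rw [← h3, ← h4]
    ring
  have := Nat.sInf_le hmem
  change level Q ≤ _ at this
  omega

theorem exists_not_dvd_of_prime_dvd_level {p : ℕ} (hp : p.Prime) (hpl : p ∣ level Q)
    {M : Matrix (Fin n) (Fin n) ℤ} (hM : (level Q : ℚ) • Q = M.map (Int.cast : ℤ → ℚ)) :
    ∃ i j, ¬ (p : ℤ) ∣ M i j := by
  by_contra! h
  choose N hN using h
  obtain ⟨c, hc⟩ := hpl
  have hpos := (level_spec Q).1
  have hp0 : (p : ℚ) ≠ 0 := by exact_mod_cast hp.ne_zero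
  have h1 : ((c : ℤ) : ℚ) • Q = (Matrix.of N).map (Int.cast : ℤ → ℚ) := by
    ext i j
    have h2 := congrFun (congrFun hM i) j
    simp only [Matrix.smul_apply, smul_eq_mul, Matrix.map_apply, hN, hc] at h2
    push_cast at h2
    simp only [Matrix.smul_apply, smul_eq_mul, Matrix.map_apply, Matrix.of_apply, Int.cast_natCast]
    exact mul_left_cancel₀ hp0 (by rw [← mul_assoc, h2])
  have h3 : level Q ∣ c := Int.natCast_dvd_natCast.1 (level_dvd h1)
  have hc0 : 0 < c := Nat.pos_of_ne_zero fun h0 => by rw [h0] at hc; omega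
  have h4 := Nat.le_of_dvd hc0 h3
  have := hp.two_le
  rw [hc] at h4
  nlinarith

variable {G H : OrientedGraph (Fin n)}

/-- Multiply `Qᵀ W(G) = W(H)` on the right by the adjugate of `W(G)`. -/
theorem level_dvd_det_skewWalk (hQ : Q ∈ transition G H) : (level Q : ℤ) ∣ G.skewWalk.det := by
  refine level_dvd (M := (H.skewWalk * G.skewWalk.adjugate)ᵀ) ?_
  have h1 : Qᵀ * (G.skewWalk * G.skewWalk.adjugate).map (Int.cast : ℤ → ℚ) =
      (H.skewWalk * G.skewWalk.adjugate).map (Int.cast : ℤ → ℚ) := by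
    rw [map_intCast_mul, map_intCast_mul, ← Matrix.mul_assoc,
      transpose_mul_skewWalk_of_mem_transition hQ]
  rw [transpose_map, ← h1, mul_adjugate, transpose_mul, transpose_transpose]
  rw [map_intCast_zsmul, Matrix.map_one _ Int.cast_zero Int.cast_one, transpose_smul,
    transpose_one, Matrix.smul_mul, Matrix.one_mul]

theorem transpose_mul_pow_mul_of_smul_eq (hQ : Q ∈ transition G H) {l : ℕ}
    {M : Matrix (Fin n) (Fin n) ℤ} (hM : (l : ℚ) • Q = M.map (Int.cast : ℤ → ℚ)) (k : ℕ) :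
    Mᵀ * G.skewAdj ^ k * M = (l ^ 2 : ℤ) • H.skewAdj ^ k := by
  apply Matrix.map_injective (Int.cast_injective (α := ℚ))
  beta_reduce
  rw [map_intCast_zsmul, map_intCast_mul, map_intCast_mul, transpose_map, ← hM, map_intCast_pow,
    map_intCast_pow, ← transpose_mul_pow_mul_of_mem_transition hQ, Int.cast_pow, Int.cast_natCast]
  simp only [transpose_smul, Matrix.smul_mul, Matrix.mul_smul, smul_smul, pow_two]

theorem transpose_mulVec_pow_of_smul_eq (hQ : Q ∈ transition G H) {l : ℕ}
    {M : Matrix (Fin n) (Fin n) ℤ} (hM : (l : ℚ) • Q = M.map (Int.cast : ℤ → ℚ)) (k : ℕ) :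
    Mᵀ *ᵥ ((G.skewAdj ^ k) *ᵥ 1) = (l : ℤ) • ((H.skewAdj ^ k) *ᵥ 1) := by
  ext i
  have h := congrFun (transpose_mulVec_pow_of_mem_transition hQ k) i
  rw [← Int.cast_inj (α := ℚ)]
  have h1 : ∀ (A : Matrix (Fin n) (Fin n) ℤ) (x : Fin n → ℤ) (i : Fin n),
      ((A *ᵥ x) i : ℚ) = (A.map (Int.cast : ℤ → ℚ) *ᵥ fun j => (x j : ℚ)) i := fun A x i =>
    (map_mulVec_intCast ℚ A x i).symm
  have h2 : (fun j => (((1 : Fin n → ℤ) j : ℤ) : ℚ)) = 1 := by ext; simp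
  have h3 : ∀ (A : Matrix (Fin n) (Fin n) ℤ), (fun j => ((A *ᵥ 1) j : ℚ)) =
      A.map (Int.cast : ℤ → ℚ) *ᵥ 1 := fun A => by ext i; rw [h1, h2]
  rw [h1, h3, map_intCast_pow, transpose_map, ← hM, transpose_smul, smul_mulVec, Pi.smul_apply,
    h, Pi.smul_apply, smul_eq_mul, smul_eq_mul, Int.cast_mul, h1, h2, map_intCast_pow,
    Int.cast_natCast]

end Level

end OrientedGraph

/-! ### Level one: permutation matrices and isomorphisms -/

/-- An integral orthogonal matrix with row sums `1` is a permutation matrix. -/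
theorem exists_equiv_of_transpose_mul_self {n : ℕ} {M : Matrix (Fin n) (Fin n) ℤ}
    (hM : Mᵀ * M = 1) (he : M *ᵥ 1 = 1) :
    ∃ f : Fin n ≃ Fin n, ∀ i j, M i j = if i = f j then 1 else 0 := by
  have hM' : M * Mᵀ = 1 := mul_eq_one_comm.1 hM
  have h01 : ∀ i j, M i j = 0 ∨ M i j = 1 := by
    intro i j
    have h1 : ∑ j, M i j * M i j = 1 := by
      have := congrFun (congrFun hM' i) i
      rwa [Matrix.mul_apply, one_apply_eq] at this
    have h2 : ∑ j, M i j = 1 := by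
      have := congrFun he i
      simpa [mulVec, dotProduct] using this
    -- Each row has sum and sum of squares `1`, and `a ^ 2 - a ≥ 0` for integers, so every term
    -- vanishes.
    have h3 : ∑ j, (M i j * M i j - M i j) = 0 := by
      rw [Finset.sum_sub_distrib, h1, h2, sub_self]
    have hnonneg : ∀ j ∈ Finset.univ, 0 ≤ M i j * M i j - M i j := fun j _ => by
      rcases le_or_gt (M i j) 0 with h | h <;> nlinarith
    have h4 := (Finset.sum_eq_zero_iff_of_nonneg hnonneg).1 h3 j (Finset.mem_univ _)
    have h5 : M i j * (M i j - 1) = 0 := by linarith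
    rcases mul_eq_zero.1 h5 with h | h
    · exact Or.inl h
    · exact Or.inr (by linarith)
  have hnn : ∀ i j k l, 0 ≤ M i j * M k l := fun i j k l => by
    rcases h01 i j with h | h <;> rcases h01 k l with h' | h' <;> simp [h, h']
  have hcol : ∀ j, ∃ i, M i j = 1 := by
    intro j
    by_contra! h
    have := congrFun (congrFun hM j) j
    rw [Matrix.mul_apply, one_apply_eq, Finset.sum_eq_zero] at this
    · exact zero_ne_one this
    · intro i _
      rw [(h01 i j).resolve_right (h i), mul_zero]
  choose f hf using hcol
  have hf' : ∀ i j, M i j = 1 → i = f j := by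
    intro i j hij
    by_contra hne
    have h1 := congrFun (congrFun hM' i) (f j)
    rw [Matrix.mul_apply, one_apply_ne hne] at h1
    have h2 := (Finset.sum_eq_zero_iff_of_nonneg fun _ _ => hnn _ _ _ _).1 h1 j (Finset.mem_univ _)
    change M i j * M (f j) j = 0 at h2
    rw [hij, hf] at h2
    exact one_ne_zero h2
  have hinj : Function.Injective f := by
    intro j k hjk
    by_contra hne
    have h1 := congrFun (congrFun hM j) k
    rw [Matrix.mul_apply, one_apply_ne hne] at h1
    have h2 := (Finset.sum_eq_zero_iff_of_nonneg fun _ _ => hnn _ _ _ _).1 h1 (f j)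
      (Finset.mem_univ _)
    change M (f j) j * M (f j) k = 0 at h2
    rw [hf, hjk, hf] at h2
    exact one_ne_zero h2
  refine ⟨Equiv.ofBijective f (Finite.injective_iff_bijective.1 hinj), fun i j => ?_⟩
  rw [Equiv.ofBijective_apply]
  split_ifs with h
  · rw [h, hf]
  · exact (h01 i j).resolve_right fun h1 => h (hf' i j h1)

namespace OrientedGraph

variable {n : ℕ} {G H : OrientedGraph (Fin n)} {Q Q₀ : Matrix (Fin n) (Fin n) ℚ}

theorem isomorphic_of_level_eq_one (hQ : Q ∈ transition G H) (hl : level Q = 1) :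
    H.Isomorphic G := by
  obtain ⟨-, M, hM⟩ := level_spec Q
  have h0 := transpose_mul_pow_mul_of_smul_eq hQ hM 0
  have h1 := transpose_mul_pow_mul_of_smul_eq hQ hM 1
  have he := hQ.1.2
  rw [hl] at h0 h1 hM
  simp only [Nat.cast_one, one_pow, one_smul, pow_zero, Matrix.mul_one, pow_one] at h0 h1 hM
  have he' : M *ᵥ 1 = 1 := by
    ext i
    rw [hM] at he
    have h2 := congrFun he i
    rw [← Int.cast_inj (α := ℚ)]
    simpa [mulVec, dotProduct] using h2
  obtain ⟨f, hf⟩ := exists_equiv_of_transpose_mul_self h0 he'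
  refine ⟨f, fun u v => ?_⟩
  rw [← skewAdj_eq_one_iff, ← skewAdj_eq_one_iff, ← h1]
  simp [Matrix.mul_apply, hf]

theorem permutation_mem_transition (f : Fin n ≃ Fin n)
    (hf : ∀ u v, H.skewAdj u v = G.skewAdj (f u) (f v)) :
    (Matrix.of fun i j => if i = f j then (1 : ℚ) else 0) ∈ transition G H := by
  refine ⟨⟨(mem_orthogonalGroup_iff' _ _).2 ?_, ?_⟩, ?_⟩
  · ext i j
    by_cases h : i = j
    · subst h; simp [Matrix.mul_apply]
    · simp [Matrix.mul_apply, h, Ne.symm h]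
  · ext i
    simp only [mulVec, dotProduct, Matrix.of_apply, Pi.one_apply, mul_one]
    rw [← f.symm.sum_comp]
    simp
  · ext i j
    simp [Matrix.mul_apply, hf]

theorem exists_mem_transition_converse_level_eq_one (h : G.SelfConverse) :
    ∃ Q ∈ transition G G.converse, level Q = 1 := by
  obtain ⟨f, hf⟩ := h
  refine ⟨_, permutation_mem_transition f fun u v => ?_, ?_⟩
  · have h1 : ∀ u v, G.Adj u v ↔ G.Adj (f v) (f u) := hf
    rw [skewAdj_converse, transpose_apply]
    classical
    exact if_congr (h1 v u) rfl (if_congr (h1 u v) rfl rfl)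
  · have h2 : (level (Matrix.of fun i j => if i = f j then (1 : ℚ) else 0) : ℤ) ∣ 1 := by
      refine level_dvd (M := Matrix.of fun i j => if i = f j then 1 else 0) ?_
      ext i j
      simp
    exact Nat.dvd_one.1 (by exact_mod_cast h2)

/-! ### Primes dividing the level -/

section Columns

variable {l : ℕ} {M : Matrix (Fin n) (Fin n) ℤ}

theorem pow_mulVec_one_dotProduct_col (hQ : Q ∈ transition G H)
    (hM : (l : ℚ) • Q = M.map (Int.cast : ℤ → ℚ)) (j : Fin n) (k : ℕ) :
    ((G.skewAdj ^ k) *ᵥ 1) ⬝ᵥ M.col j = l * ((H.skewAdj ^ k) *ᵥ 1) j := by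
  rw [dotProduct_comm]
  exact congrFun (transpose_mulVec_pow_of_smul_eq hQ hM k) j

theorem col_dotProduct_pow_mulVec_col (hQ : Q ∈ transition G H)
    (hM : (l : ℚ) • Q = M.map (Int.cast : ℤ → ℚ)) (j : Fin n) (k : ℕ) :
    M.col j ⬝ᵥ ((G.skewAdj ^ k) *ᵥ M.col j) = l ^ 2 * (H.skewAdj ^ k) j j := by
  have h := congrFun (congrFun (transpose_mul_pow_mul_of_smul_eq hQ hM k) j) j
  rw [Matrix.mul_assoc] at h
  exact h

end Columns

theorem not_two_dvd_level {m : ℤ} (hm : Odd m) (hdet : G.skewWalk.det = 2 ^ (n / 2) * m)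
    (hQ : Q ∈ transition G H) : ¬ 2 ∣ level Q := by
  intro h2
  obtain ⟨-, M, hM⟩ := level_spec Q
  obtain ⟨i, j, hij⟩ := exists_not_dvd_of_prime_dvd_level Nat.prime_two h2 hM
  have h2' : (2 : ℤ) ∣ level Q := by exact_mod_cast h2
  refine hij (two_dvd_of_krylov_transpose_mulVec G.skewAdj_transpose hm hdet (u := M.col j)
    (fun k => ?_) (fun k => ?_) i)
  · rw [krylov_transpose_mulVec, pow_mulVec_one_dotProduct_col hQ hM]
    exact h2'.mul_right _
  · rw [col_dotProduct_pow_mulVec_col hQ hM]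
    exact Dvd.dvd.mul_right (pow_dvd_pow_of_dvd h2' 2) _

theorem sq_dvd_det_of_prime_dvd_level {p : ℕ} (hp : p.Prime) (hp2 : p ≠ 2)
    (hQ₀ : Q₀ ∈ transition G G.converse) (hQ : Q ∈ transition G H) (hpl : p ∣ level Q)
    (hpl₀ : ¬ p ∣ level Q₀) : (p : ℤ) ^ 2 ∣ G.skewWalk.det := by
  have : Fact p.Prime := ⟨hp⟩
  by_contra hdet
  obtain ⟨-, M, hM⟩ := level_spec Q
  obtain ⟨-, N, hN⟩ := level_spec Q₀
  obtain ⟨i, j, hij⟩ := exists_not_dvd_of_prime_dvd_level hp hpl hM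
  set z := M.col j with hz
  have hpl' : (p : ℤ) ∣ level Q := by exact_mod_cast hpl
  have hS := G.skewAdj_transpose
  set S := G.skewAdj with hSdef
  have hzp0 : (fun i => (z i : ZMod p)) ≠ 0 := fun h =>
    hij ((ZMod.intCast_zmod_eq_zero_iff_dvd _ _).1 (congrFun h i))
  have hk : ∀ k, (p : ℤ) ∣ ((S ^ k) *ᵥ 1) ⬝ᵥ z := fun k => by
    rw [pow_mulVec_one_dotProduct_col hQ hM]
    exact hpl'.mul_right _
  have hker : ∀ w : Fin n → ℤ, (∀ k : ℕ, (p : ℤ) ∣ ((S ^ k) *ᵥ 1) ⬝ᵥ w) →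
      ∃ c : ZMod p, (fun i => (w i : ZMod p)) = c • fun i => (z i : ZMod p) := by
    intro w hw
    have key : ∀ w : Fin n → ℤ, (∀ k : ℕ, (p : ℤ) ∣ ((S ^ k) *ᵥ 1) ⬝ᵥ w) →
        (krylov (S.map (Int.cast : ℤ → ZMod p)))ᵀ *ᵥ (fun i => (w i : ZMod p)) = 0 := by
      intro w hw
      ext i
      rw [krylov_map_intCast, ← transpose_map, map_mulVec_intCast, krylov_transpose_mulVec,
        Pi.zero_apply, ZMod.intCast_zmod_eq_zero_iff_dvd]
      exact hw i
    exact exists_eq_smul_of_krylov_transpose_mulVec_eq_zero hdet hzp0 (key z hk) (key w hw)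
  obtain ⟨a, ha⟩ := hker (S *ᵥ z) fun k => by
    have h1 : ((S ^ k) *ᵥ 1) ⬝ᵥ (S *ᵥ z) = -(((S ^ (k + 1)) *ᵥ 1) ⬝ᵥ z) := by
      rw [dotProduct_mulVec_of_skew hS, mulVec_mulVec, ← pow_succ']
    rw [h1]
    exact (hk _).neg_right
  -- `Nᵀ` sends `S ^ k e` to `± ℓ₀ S ^ k e`, so `N` preserves the kernel of `Wᵀ` modulo `p`.
  obtain ⟨c, hc⟩ := hker (N *ᵥ z) fun k => by
    have h1 := transpose_mulVec_pow_of_smul_eq hQ₀ hN k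
    rw [dotProduct_mulVec, ← mulVec_transpose, h1, skewAdj_converse, ← transpose_pow,
      transpose_pow_of_skew hS, smul_mulVec, smul_dotProduct, smul_dotProduct]
    rcases neg_one_pow_eq_or ℤ k with h | h <;> rw [h] <;> simpa using (hk k).mul_left _
  have hSN : S * N = -(N * S) := by
    have hNN' : N * Nᵀ = (level Q₀ ^ 2 : ℤ) • 1 := by
      apply Matrix.map_injective (Int.cast_injective (α := ℚ))
      beta_reduce
      rw [map_intCast_mul, map_intCast_zsmul, transpose_map, ← hN, transpose_smul,
        smul_mul_smul_comm,
        mul_transpose_self_of_mem_transition hQ₀, Matrix.map_one _ Int.cast_zero Int.cast_one]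
      push_cast
      rw [pow_two]
    have h1 := transpose_mul_pow_mul_of_smul_eq hQ₀ hN 1
    rw [pow_one, pow_one, skewAdj_converse, ← hSdef, hS] at h1
    have h2 := congrArg (fun B => N * B) h1
    beta_reduce at h2
    rw [← Matrix.mul_assoc, ← Matrix.mul_assoc, hNN', Matrix.smul_mul, Matrix.one_mul,
      Matrix.smul_mul, Matrix.mul_smul, Matrix.mul_neg] at h2
    refine smul_right_injective _ (r := (level Q₀ ^ 2 : ℤ)) ?_ h2
    have := (level_spec Q₀).1
    positivity
  have hcast : ∀ (B : Matrix (Fin n) (Fin n) ℤ) (w : Fin n → ℤ),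
      (fun i => ((B *ᵥ w) i : ZMod p)) = B.map (Int.cast : ℤ → ZMod p) *ᵥ fun i => (w i : ZMod p) :=
    fun B w => funext fun i => (map_mulVec_intCast _ B w i).symm
  rw [hcast] at ha hc
  set zp : Fin n → ZMod p := fun i => (z i : ZMod p)
  have hc0 : c ≠ 0 := by
    rintro rfl
    have hNN : Nᵀ * N = (level Q₀ ^ 2 : ℤ) • 1 := by
      simpa using transpose_mul_pow_mul_of_smul_eq hQ₀ hN 0
    have h1 := congrArg
      (fun B : Matrix (Fin n) (Fin n) ℤ => B.map (Int.cast : ℤ → ZMod p) *ᵥ zp) hNN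
    beta_reduce at h1
    rw [map_intCast_mul, ← mulVec_mulVec, hc, zero_smul, mulVec_zero, map_intCast_zsmul,
      Matrix.map_one _ Int.cast_zero Int.cast_one, smul_mulVec, one_mulVec, eq_comm,
      smul_eq_zero] at h1
    have h2 := h1.resolve_right hzp0
    push_cast at h2
    exact hpl₀ ((ZMod.natCast_eq_zero_iff _ _).1 (pow_eq_zero_iff two_ne_zero |>.1 h2))
  -- Anticommutation applied to the common eigenvector `z` gives `2 a c = 0`; here `p ≠ 2` is
  -- needed.
  have ha0 : a = 0 := by
    have h1 := congrArg
      (fun B : Matrix (Fin n) (Fin n) ℤ => B.map (Int.cast : ℤ → ZMod p) *ᵥ zp) hSN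
    beta_reduce at h1
    have hneg : (-(N * S)).map (Int.cast : ℤ → ZMod p) =
        -((N * S).map (Int.cast : ℤ → ZMod p)) := by
      ext; simp
    rw [hneg, neg_mulVec, map_intCast_mul, map_intCast_mul, ← mulVec_mulVec, ← mulVec_mulVec,
      hc, ha, mulVec_smul, mulVec_smul, hc, ha, smul_smul, smul_smul, eq_neg_iff_add_eq_zero,
      ← add_smul,
      smul_eq_zero, mul_comm a c] at h1
    exact (mul_eq_zero.1 ((ZMod.add_self_eq_zero_iff_eq_zero (hp.odd_of_ne_two hp2)).1
      (h1.resolve_right hzp0))).resolve_left hc0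
  refine hdet (sq_dvd_det_krylov hS hzp0 (fun i => ?_) (by simpa using hk 0) ?_)
  · rw [← ZMod.intCast_zmod_eq_zero_iff_dvd, ← map_mulVec_intCast]
    have h1 := congrFun ha i
    rw [ha0, zero_smul] at h1
    exact h1
  · have h1 := col_dotProduct_pow_mulVec_col hQ hM j 0
    rw [pow_zero, one_mulVec] at h1
    rw [hz, h1, pow_two, mul_assoc]
    exact hpl'.mul_right _

end OrientedGraph

/-! ### The theorem -/

open OrientedGraph in
theorem theoreml (n : ℕ) (G : OrientedGraph (Fin n)) (hG : G ∈ oddSquarefreeClass n) :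
    (∃! Q₀ : Matrix (Fin n) (Fin n) ℚ, Q₀ ∈ transition G G.converse) ∧
    (∀ Q₀ ∈ transition G G.converse, ∀ Q ∈ transitions G, level Q ∣ level Q₀) ∧
    (G.SelfConverse → G.IsDGSS) := by
  obtain ⟨m, hdet, hm, hsq⟩ := hG
  have hdet0 : G.skewWalk.det ≠ 0 := by
    rw [hdet]
    exact mul_ne_zero (by positivity) hsq.ne_zero
  have hlevel : ∀ Q₀ ∈ transition G G.converse, ∀ Q ∈ transitions G, level Q ∣ level Q₀ := by
    intro Q₀ hQ₀ Q hQ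
    obtain ⟨H, hQ⟩ := Set.mem_iUnion.1 hQ
    have hodd := not_two_dvd_level hm hdet hQ
    have hlm : (level Q : ℤ) ∣ m := by
      have h1 := level_dvd_det_skewWalk hQ
      rw [hdet] at h1
      refine IsCoprime.dvd_of_dvd_mul_left (IsCoprime.pow_right ?_) h1
      rw [Int.isCoprime_two_right, Int.odd_iff]
      omega
    have hlsq : Squarefree (level Q) := by
      have h1 := hsq.squarefree_of_dvd hlm
      rwa [Int.squarefree_natCast] at h1
    -- A square-free level is the product of its prime factors, so divisibility can be checked one
    -- prime at a time.
    rw [← Nat.prod_primeFactors_of_squarefree hlsq]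
    refine Finset.prod_primes_dvd _ (fun p hp => (Nat.prime_of_mem_primeFactors hp).prime)
      fun p hp => ?_
    have hp1 := Nat.prime_of_mem_primeFactors hp
    have hpl := Nat.dvd_of_mem_primeFactors hp
    have hp2 : p ≠ 2 := by rintro rfl; exact hodd hpl
    by_contra hpl₀
    have h2 := sq_dvd_det_of_prime_dvd_level hp1 hp2 hQ₀ hQ hpl hpl₀
    rw [hdet] at h2
    have hpodd : IsCoprime ((p : ℤ) ^ 2) (2 ^ (n / 2)) := by
      refine IsCoprime.pow ?_
      rw [Int.isCoprime_two_right]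
      exact_mod_cast hp1.odd_of_ne_two hp2
    have h3 := hsq p (by rw [← pow_two]; exact hpodd.dvd_of_dvd_mul_left h2)
    exact (Nat.prime_iff_prime_int.1 hp1).not_isUnit h3
  refine ⟨?_, hlevel, ?_⟩
  · obtain ⟨Q₀, hQ₀⟩ := nonempty_transition hdet0 G.genSkewSpec_converse
    exact ⟨Q₀, hQ₀, fun Q hQ => transition_subsingleton hdet0 hQ hQ₀⟩
  · intro hself H hH
    obtain ⟨Q₀, hQ₀, hl₀⟩ := exists_mem_transition_converse_level_eq_one hself
    obtain ⟨Q, hQ⟩ := nonempty_transition hdet0 hH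
    have h1 := hlevel Q₀ hQ₀ Q (Set.mem_iUnion.2 ⟨H, hQ⟩)
    rw [hl₀, Nat.dvd_one] at h1
    exact isomorphic_of_level_eq_one hQ h1
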